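/- Fix a real number $v>1$ and put $q=v^2$. Let $T^n=(\mathbb C^\times)^n$ with coordinate characters $t_1,\dots,t_n$, which form a basis of $X=\mathbb Z^n$, and let $R_0$ be the root system of type $B_n$, with roots (written multiplicatively) $t_i^{\pm1}$ and $t_i^{\pm1}t_j^{\pm1}$ ($i<j$), coroots $\pm 2e_i$ and $\pm e_i\pm e_j$, and standard pairing. A normalised affine Hecke algebra $\mathcal H^n_{m_-,m_+}$ of type $B_n$ with base $q^{b}$ ($b\in\{1,2\}$, $b(m_+\pm m_-)\in\mathbb Z$) has parameters $$\mathtt m_-(t_i^{\pm1}t_j^{\pm 1})=0,\quad \mathtt m_+(t_i^{\pm1}t_j^{\pm 1})=b,\quad \mathtt m_-(t_i^{\pm1})=b\,m_-,\quad \mathtt m_+(t_i^{\pm1})=b\,m_+$$ and a normalising factor $d=d(v)$. Its $\mu$-function is the rational function on $T^n$ $$\mu=d\,v^{-2\mathtt m_W(w_0)}\prod_{\alpha\in R_0}\frac{1-\alpha^{-2}}{(1-v^{-2\mathtt m_+(\alpha)}\alpha^{-1})(1+v^{-2\mathtt m_-(\alpha)}\alpha^{-1})},\qquad \mathtt m_W(w_0)=\sum_{\alpha>0}(\mathtt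 m_+(\alpha)+\mathtt m_-(\alpha)).$$ For a coset $L\subset T^n$ of a subtorus and a sign $\epsilon=\pm$ put $p_\epsilon(L)=\{\alpha\in R_0:\epsilon\alpha|_L=v^{-2\mathtt m_\epsilon(\alpha)}\}$ and $z_\epsilon(L)=\{\alpha\in R_0:\epsilon\alpha|_L=1\}$. The coset $L$ is residual if $|p_+(L)|+|p_-(L)|-|z_+(L)|-|z_-(L)|=\operatorname{codim}L$. In that case the regularisation $\mu^{(L)}$ is the restriction to $L$ of $$d\,v^{-2\mathtt m_W(w_0)}\,\frac{\prod_{\alpha\notin z_-(L)}(1+\alpha^{-1})\prod_{\alpha\notin z_+(L)}(1-\alpha^{-1})}{\prod_{\alpha\notin p_-(L)}(1+v^{-2\mathtt m_-(\alpha)}\alpha^{-1})\prod_{\alpha\notin p_+(L)}(1-v^{-2\mathtt m_+(\alpha)}\alpha^{-1})}.$$ Let $T_L$ be the subtorus whose cocharacters are those in the rational span of the coroots of the roots that are constant on $L$. A map $\phi:T_1\to T_2$ (depending on $v$) between the tori of two normalised affine Hecke algebras is a spectral transfer morphism if its image $L$ is a residual coset and * (T1) $\phi$ is a finite morphism of algebraic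 varieties; * (T2) $\phi(e)\in L\cap T_L$, and $\phi$ is a homomorphism of tori when $\phi(e)$ is taken as the base point of $L$; * (T3) there is a constant $c\in\mathbb Q^\times$, independent of $v$, with $\phi^*(\mu_2^{(L)})=c\,\mu_1$ as rational functions on $T_1$. For $m\in\mathbb Z\pm\frac14$ write $|m|=\kappa+\frac{2\epsilon-1}4$ with $\kappa\in\mathbb Z_{\ge0}$ and $\epsilon\in\{0,1\}$; let $\delta\in\{0,1\}$ be the parity of $\kappa$. For $m>1$ let $\sigma_e(m)=(q^{\delta},q^{\delta+1},\dots,q^{2m-3/2})$; put $r_e(\frac14)=r_e(\frac34)=\emptyset$, and $r_e(m)=(\sigma_e(m);r_e(m-1))$ if $m>1$. **Proposition.** Let $r\ge0$ be an integer and let $m_-,m_+\in\mathbb Z\pm\frac14$ be positive, with associated $\kappa_\pm,\epsilon_\pm,\delta_\pm$. Put $l=2r+\lfloor l_-\rfloor+\lfloor l_+\rfloor$, where $l_\pm=\kappa_\pm(\kappa_\pm+\epsilon_\pm-\frac12)$. Then $$\xi:T^r\to T^l,\qquad \xi(s_1,\dots,s_r)=\bigl(-r_e(m_-),v^{-1}s_1,vs_1,\dots,v^{-1}s_r,vs_r,r_e(m_+)\bigr)$$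 is a spectral transfer morphism from $\mathcal H^r_{m_-,m_+}$ with base $q^2$ and normalising factor $$d=(v^2-v^{-2})^{-r}\prod_{i=1}^{\lfloor|m_--m_+|\rfloor}\Bigl(\frac{v^{2|m_--m_+|-2i}}{1+q^{2|m_--m_+|-2i}}\Bigr)^{i}\prod_{j=1}^{\lfloor m_-+m_+\rfloor}\Bigl(\frac{v^{2(m_-+m_+)-2j}}{1+q^{2(m_-+m_+)-2j}}\Bigr)^{j}$$ to $\mathcal H^l_{\delta_-,\delta_+}$ with base $q$ and normalising factor $d=(v-v^{-1})^{-l}(v+v^{-1})^{-\delta_-\delta_+}$. -/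

import Mathlib

namespace AffHecke

noncomputable section

/-! ### Tori and their coordinate rings -/

/-- The complex algebraic torus with character lattice `ℤⁿ`, given by its points. -/
abbrev Torus (n : ℕ) : Type := Fin n → ℂˣ

/-- The value `χ(t) = ∏ tᵢ ^ χᵢ` of the character `χ ∈ ℤⁿ` at the point `t`. -/
def charVal {n : ℕ} (χ : Fin n → ℤ) (t : Torus n) : ℂˣ := ∏ i, t i ^ χ i

theorem charVal_zero {n : ℕ} (t : Torus n) : charVal 0 t = 1 := by
  simp [charVal]

theorem charVal_add {n : ℕ} (χ ψ : Fin n → ℤ) (t : Torus n) :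
    charVal (χ + ψ) t = charVal χ t * charVal ψ t := by
  simp [charVal, zpow_add, Finset.prod_mul_distrib]

/-- The coordinate ring `ℂ[ℤⁿ]` of the torus. -/
abbrev CoordRing (n : ℕ) : Type := AddMonoidAlgebra ℂ (Fin n → ℤ)

/-- Evaluation of regular functions at a point of the torus. -/
def evalAt {n : ℕ} (t : Torus n) : CoordRing n →ₐ[ℂ] ℂ :=
  AddMonoidAlgebra.lift ℂ ℂ (Fin n → ℤ)
    { toFun := fun χ => (charVal χ.toAdd t : ℂ)
      map_one' := by simp [charVal_zero]
      map_mul' := fun χ ψ => by simp [charVal_add] }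

/-- The map on points `φ` is a finite morphism of algebraic varieties: it is induced by a
homomorphism of coordinate rings that makes the ring of the source a finite module. -/
def IsFiniteMorphism {n k : ℕ} (φ : Torus n → Torus k) : Prop :=
  ∃ Φ : CoordRing k →ₐ[ℂ] CoordRing n,
    (∀ (f : CoordRing k) (s : Torus n), evalAt s (Φ f) = evalAt (φ s) f) ∧
    Φ.toRingHom.Finite

/-! ### Normalised affine Hecke algebras -/

/-- The data that determine a normalised generic affine Hecke algebra `(ℋ(ℛ, m), d)` with
character lattice `X = ℤⁿ`: a root datum, a parameter function `m_R` on the affine roots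
`R₀^∨ × ℤ` (`mR i k` is its value at `αᵢ^∨ + k`), invariant under the extended affine Weyl group
`X ⋊ W₀`, and the normalising factor `d`, a function of `v`. -/
structure NormalizedHecke (ι : Type) (n : ℕ) where
  datum : RootDatum ι (Fin n → ℤ) (Fin n → ℤ)
  mR : ι → ℤ → ℤ
  mR_translation : ∀ (i : ι) (k : ℤ) (x : Fin n → ℤ),
    mR i (k + datum.toLinearMap x (datum.coroot i)) = mR i k
  mR_reflection : ∀ (i j : ι) (k : ℤ), mR (datum.reflectionPerm i j) k = mR j k
  d : ℝ → ℝ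

/-- The specialisation parameter: a real number `v > 1`, with `q = v ^ 2`. -/
abbrev Param : Type := Set.Ioi (1 : ℝ)

/-- `v` as a nonzero complex number. -/
def Param.unit (v : Param) : ℂˣ :=
  Units.mk0 ((v : ℝ) : ℂ) (Complex.ofReal_ne_zero.mpr (lt_trans one_pos v.2).ne')

namespace NormalizedHecke

variable {ι : Type} {n : ℕ} (D : NormalizedHecke ι n)

/-- The value `α(t)` of the root with index `i`. -/
def rootVal (i : ι) (t : Torus n) : ℂˣ := charVal (D.datum.root i) t

/-- `2 m₊(α) = m_R(α^∨) + m_R(1 + α^∨)`. -/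
def twoMPlus (i : ι) : ℤ := D.mR i 0 + D.mR i 1

/-- `2 m₋(α) = m_R(α^∨) - m_R(1 + α^∨)`. -/
def twoMMinus (i : ι) : ℤ := D.mR i 0 - D.mR i 1

/-- `2 m_W(w₀)`, where `m_W(w)` is the sum of `m_R` over the positive affine roots made negative
by `w`. For the longest element `w₀` of the finite Weyl group these are the positive coroots, and
`m_R` takes equal values at `α^∨` and `-α^∨`, so twice the sum is the sum over all coroots. -/
def twoMW [Fintype ι] : ℤ := ∑ i, D.mR i 0

/-- `p₊(L)`: the roots that are identically `v ^ (-2 m₊(α))` on `L`. -/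
def pPlus (v : Param) (L : Set (Torus n)) : Set ι :=
  {i | ∀ t ∈ L, D.rootVal i t = v.unit ^ (-D.twoMPlus i)}

/-- `p₋(L)`: the roots such that `-α` is identically `v ^ (-2 m₋(α))` on `L`. -/
def pMinus (v : Param) (L : Set (Torus n)) : Set ι :=
  {i | ∀ t ∈ L, -D.rootVal i t = v.unit ^ (-D.twoMMinus i)}

/-- `z₊(L)`: the roots that are identically `1` on `L`. -/
def zPlus (L : Set (Torus n)) : Set ι := {i | ∀ t ∈ L, D.rootVal i t = 1}

/-- `z₋(L)`: the roots that are identically `-1` on `L`. -/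
def zMinus (L : Set (Torus n)) : Set ι := {i | ∀ t ∈ L, -D.rootVal i t = 1}

/-- `L` is a residual coset. A coset of a subtorus is the set of points where the characters of a
saturated sublattice `X'` take prescribed values (those at a point `b`); its codimension is the
rank of `X'`. -/
def IsResidualCoset (v : Param) (L : Set (Torus n)) : Prop :=
  ∃ X' : Submodule ℤ (Fin n → ℤ),
    (∀ (k : ℤ) (χ : Fin n → ℤ), k ≠ 0 → k • χ ∈ X' → χ ∈ X') ∧
    (∃ b : Torus n, L = {t | ∀ χ ∈ X', charVal χ t = charVal χ b}) ∧
    ((D.pPlus v L).ncard : ℤ) + (D.pMinus v L).ncard - (D.zPlus L).ncard - (D.zMinus L).ncard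
      = Module.finrank ℤ X'

/-- `R_L`: the roots that are constant on `L`. -/
def constRoots (L : Set (Torus n)) : Set ι :=
  {i | ∀ t ∈ L, ∀ t' ∈ L, D.rootVal i t = D.rootVal i t'}

/-- `T_L`: the subtorus whose cocharacters are the `y ∈ Y` in the rational span of the coroots of
`R_L`, i.e. the common kernel of the characters orthogonal to these coroots. -/
def subtorusOf (L : Set (Torus n)) : Set (Torus n) :=
  {t | ∀ χ : Fin n → ℤ,
    (∀ i ∈ D.constRoots L, D.datum.toLinearMap χ (D.datum.coroot i) = 0) → charVal χ t = 1}

open scoped Classical in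
/-- Numerator of the regularisation of the `μ`-function along `L`. -/
def muRegNum [Fintype ι] (v : Param) (L : Set (Torus n)) (t : Torus n) : ℂ :=
  (D.d v : ℂ) * (v.unit : ℂ) ^ (-D.twoMW) *
    (∏ i with i ∉ D.zMinus L, (1 + (D.rootVal i t : ℂ)⁻¹)) *
    ∏ i with i ∉ D.zPlus L, (1 - (D.rootVal i t : ℂ)⁻¹)

open scoped Classical in
/-- Denominator of the regularisation of the `μ`-function along `L`. -/
def muRegDen [Fintype ι] (v : Param) (L : Set (Torus n)) (t : Torus n) : ℂ :=
  (∏ i with i ∉ D.pMinus v L,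
      (1 + (v.unit : ℂ) ^ (-D.twoMMinus i) * (D.rootVal i t : ℂ)⁻¹)) *
    ∏ i with i ∉ D.pPlus v L,
      (1 - (v.unit : ℂ) ^ (-D.twoMPlus i) * (D.rootVal i t : ℂ)⁻¹)

/-- Numerator of the `μ`-function `d v^(-2 m_W(w₀)) ∏_{α ∈ R₀} c(α)⁻¹`, where
`c(α) = (1 - v^(-2 m₊(α)) α⁻¹) (1 + v^(-2 m₋(α)) α⁻¹) / (1 - α⁻²)`. -/
def muNum [Fintype ι] (v : Param) (t : Torus n) : ℂ :=
  (D.d v : ℂ) * (v.unit : ℂ) ^ (-D.twoMW) * ∏ i, (1 - ((D.rootVal i t : ℂ)⁻¹) ^ 2)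

/-- Denominator of the `μ`-function. -/
def muDen [Fintype ι] (v : Param) (t : Torus n) : ℂ :=
  ∏ i, ((1 - (v.unit : ℂ) ^ (-D.twoMPlus i) * (D.rootVal i t : ℂ)⁻¹) *
    (1 + (v.unit : ℂ) ^ (-D.twoMMinus i) * (D.rootVal i t : ℂ)⁻¹))

end NormalizedHecke

/-! ### Spectral transfer morphisms -/

/-- A family of maps of tori, one for each `v > 1`, is a spectral transfer morphism between two
normalised affine Hecke algebras. The rational constant in the last condition is the same for all
`v`. That condition is an identity of rational functions on the source torus; it is stated at all
points where both fractions are defined. These form a dense open set, because no factor that is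
left in a denominator vanishes identically on the source torus, respectively on the image of `φ`. -/
structure IsSpectralTransferMorphism {ι₁ ι₂ : Type} [Fintype ι₁] [Fintype ι₂] {n₁ n₂ : ℕ}
    (D₁ : NormalizedHecke ι₁ n₁) (D₂ : NormalizedHecke ι₂ n₂)
    (φ : Param → Torus n₁ → Torus n₂) : Prop where
  /-- The image is a residual coset. -/
  residual : ∀ v, D₂.IsResidualCoset v (Set.range (φ v))
  /-- `φ` is a finite morphism. -/
  finite : ∀ v, IsFiniteMorphism (φ v)
  /-- `φ` maps the identity into `L ∩ T_L`. -/
  base : ∀ v, φ v 1 ∈ Set.range (φ v) ∩ D₂.subtorusOf (Set.range (φ v))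
  /-- With `φ(e)` as base point of the image, `φ` is a homomorphism. -/
  hom : ∀ v s s', φ v (s * s') / φ v 1 = (φ v s / φ v 1) * (φ v s' / φ v 1)
  /-- The pull-back of the regularised `μ`-function is a rational multiple of the `μ`-function. -/
  pullback : ∃ c : ℚ, c ≠ 0 ∧ ∀ v s, D₁.muDen v s ≠ 0 →
    D₂.muRegDen v (Set.range (φ v)) (φ v s) ≠ 0 →
    D₂.muRegNum v (Set.range (φ v)) (φ v s) / D₂.muRegDen v (Set.range (φ v)) (φ v s) =
      (c : ℂ) * (D₁.muNum v s / D₁.muDen v s)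

/-! ### The root datum of type B -/

/-- Indices of the roots `±eᵢ` and `±eᵢ ± eⱼ` (`i < j`). -/
abbrev TypeBIndex (n : ℕ) : Type :=
  (Fin n × ℤˣ) ⊕ ({p : Fin n × Fin n // p.1 < p.2} × ℤˣ × ℤˣ)

/-- The roots of type `Bₙ` in `ℤⁿ`. -/
def typeBRoot (n : ℕ) : TypeBIndex n → (Fin n → ℤ)
  | .inl (i, e) => Pi.single i (e : ℤ)
  | .inr (p, e, f) => Pi.single p.1.1 (e : ℤ) + Pi.single p.1.2 (f : ℤ)

/-- The coroots: `±2eᵢ` and `±eᵢ ± eⱼ`. -/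
def typeBCoroot (n : ℕ) : TypeBIndex n → (Fin n → ℤ)
  | .inl (i, e) => Pi.single i (2 * (e : ℤ))
  | .inr (p, e, f) => Pi.single p.1.1 (e : ℤ) + Pi.single p.1.2 (f : ℤ)

/-- The squared length of a root. -/
def typeBNorm (n : ℕ) : TypeBIndex n → ℤ
  | .inl _ => 1
  | .inr _ => 2

theorem typeBRoot_dot (n : ℕ) (a : TypeBIndex n) :
    typeBRoot n a ⬝ᵥ typeBRoot n a = typeBNorm n a := by
  rcases a with ⟨i, e⟩ | ⟨⟨⟨i, j⟩, hij⟩, e, f⟩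
  · rcases Int.units_eq_one_or e with rfl | rfl <;> simp [typeBRoot, typeBNorm]
  · have h1 : i ≠ j := ne_of_lt hij
    rcases Int.units_eq_one_or e with rfl | rfl <;>
      rcases Int.units_eq_one_or f with rfl | rfl <;>
      simp [typeBRoot, typeBNorm, h1, h1.symm]

theorem typeBCoroot_smul (n : ℕ) (a : TypeBIndex n) :
    typeBNorm n a • typeBCoroot n a = (2 : ℤ) • typeBRoot n a := by
  rcases a with ⟨i, e⟩ | ⟨p, e, f⟩
  · ext k
    simp [typeBRoot, typeBCoroot, typeBNorm, Pi.single_apply]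
  · rfl

theorem typeBNorm_eq (n : ℕ) (a : TypeBIndex n) : typeBNorm n a = 1 ∨ typeBNorm n a = 2 := by
  rcases a with a | a <;> simp [typeBNorm]

theorem typeBRoot_injective (n : ℕ) : Function.Injective (typeBRoot n) := by
  intro a b h
  have hN : typeBNorm n a = typeBNorm n b := by
    rw [← typeBRoot_dot, ← typeBRoot_dot, h]
  have hk : ∀ k, typeBRoot n a k = typeBRoot n b k := fun k => congrFun h k
  rcases a with ⟨i, e⟩ | ⟨⟨⟨i, j⟩, hij⟩, e, f⟩ <;>
    rcases b with ⟨i', e'⟩ | ⟨⟨⟨i', j'⟩, hij'⟩, e', f'⟩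
  · have h1 := hk i
    simp only [typeBRoot, Pi.single_apply, if_true] at h1
    have he : (e : ℤ) ≠ 0 := e.ne_zero
    split_ifs at h1 with hi
    · subst hi
      rw [Units.ext h1]
    · exact absurd h1 he
  · simp [typeBNorm] at hN
  · simp [typeBNorm] at hN
  · have h1 := hk i
    have h2 := hk j
    have h3 := hk i'
    have h4 := hk j'
    simp only at hij hij'
    have n1 : i ≠ j := ne_of_lt hij
    have n2 : i' ≠ j' := ne_of_lt hij'
    have he : (e : ℤ) ≠ 0 := e.ne_zero
    have hf : (f : ℤ) ≠ 0 := f.ne_zero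
    have he' : (e' : ℤ) ≠ 0 := e'.ne_zero
    have hf' : (f' : ℤ) ≠ 0 := f'.ne_zero
    simp only [typeBRoot, Pi.single_apply, Pi.add_apply] at h1 h2 h3 h4
    have hi : i = i' := by
      by_contra hne
      by_cases hi : i = j'
      · have hlt : i' < i := hi ▸ hij'
        have hne2 : i' ≠ j := ne_of_lt (hlt.trans hij)
        simp [Ne.symm hne, n2, hne2, he'.symm] at h3
      · simp [hne, n1, hi] at h1
    have hj : j = j' := by
      by_contra hne
      subst hi
      simp [n1.symm, hne] at h2
    subst hi hj
    simp [n1] at h1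
    simp [n1.symm] at h2
    rw [Units.ext h1, Units.ext h2]

theorem exists_typeBRoot_aux (n : ℕ) (α : Fin n → ℤ) (i : Fin n) :
    ∃ β : Fin n → ℤ, α = Pi.single i (α i) + β ∧ β i = 0 ∧ α ⬝ᵥ α = α i ^ 2 + β ⬝ᵥ β := by
  have h0 : (α - Pi.single i (α i) : Fin n → ℤ) i = 0 := by simp
  refine ⟨α - Pi.single i (α i), by simp, h0, ?_⟩
  simp [sub_dotProduct, dotProduct_sub]
  ring

theorem exists_typeBRoot_one (n : ℕ) (α : Fin n → ℤ) (h : α ⬝ᵥ α = 1) :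
    ∃ (i : Fin n) (e : ℤˣ), α = Pi.single i (e : ℤ) := by
  have hne : α ≠ 0 := by rintro rfl; simp at h
  obtain ⟨i, hi⟩ := Function.ne_iff.mp hne
  obtain ⟨β, h1, h2, h3⟩ := exists_typeBRoot_aux n α i
  have hβ : 0 ≤ β ⬝ᵥ β := Finset.sum_nonneg fun k _ => mul_self_nonneg _
  have hi0 : α i ≠ 0 := hi
  have hi' : 0 < α i ^ 2 := by positivity
  have hb : β ⬝ᵥ β = 0 := by omega
  have hb0 : β = 0 := dotProduct_self_eq_zero.mp hb
  have ha : α i ^ 2 = 1 := by omega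
  obtain ⟨e, he⟩ : IsUnit (α i) := (isUnit_pow_iff two_ne_zero).mp (ha ▸ isUnit_one)
  exact ⟨i, e, by rw [he]; simpa [hb0] using h1⟩

theorem exists_typeBRoot (n : ℕ) (α : Fin n → ℤ) (h : α ⬝ᵥ α = 1 ∨ α ⬝ᵥ α = 2) :
    ∃ a, typeBRoot n a = α := by
  rcases h with h | h
  · obtain ⟨i, e, rfl⟩ := exists_typeBRoot_one n α h
    exact ⟨.inl (i, e), rfl⟩
  · have hne : α ≠ 0 := by rintro rfl; simp at h
    obtain ⟨i, hi⟩ := Function.ne_iff.mp hne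
    obtain ⟨β, h1, h2, h3⟩ := exists_typeBRoot_aux n α i
    have hβ : 0 ≤ β ⬝ᵥ β := Finset.sum_nonneg fun k _ => mul_self_nonneg _
    have hi' : α i ≠ 0 := hi
    have hle : α i ^ 2 ≤ 2 := by omega
    have hu : α i = 1 ∨ α i = -1 := by
      have u1 : α i ≤ 1 := by nlinarith
      have u2 : -1 ≤ α i := by nlinarith
      omega
    have ha : α i ^ 2 = 1 := by rcases hu with hu | hu <;> simp [hu]
    obtain ⟨e, he⟩ : IsUnit (α i) := (isUnit_pow_iff two_ne_zero).mp (ha ▸ isUnit_one)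
    obtain ⟨j, f, rfl⟩ := exists_typeBRoot_one n β (by omega)
    have hij : i ≠ j := by
      rintro rfl
      simp at h2
    rcases lt_or_gt_of_ne hij with hlt | hlt
    · exact ⟨.inr (⟨(i, j), hlt⟩, e, f), by rw [h1, ← he]; rfl⟩
    · exact ⟨.inr (⟨(j, i), hlt⟩, f, e), by rw [h1, ← he, add_comm]; rfl⟩

theorem typeBCoroot_of_root (n : ℕ) (a : TypeBIndex n) :
    typeBCoroot n a = (if typeBNorm n a = 1 then 2 else 1 : ℤ) • typeBRoot n a := by
  rcases a with ⟨i, e⟩ | ⟨p, e, f⟩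
  · ext k
    simp [typeBRoot, typeBCoroot, typeBNorm, Pi.single_apply]
  · simp [typeBRoot, typeBCoroot, typeBNorm]

theorem typeBCoroot_injective (n : ℕ) : Function.Injective (typeBCoroot n) := by
  intro a b h
  have hsq : ∀ c, typeBCoroot n c ⬝ᵥ typeBCoroot n c * typeBNorm n c = 4 := by
    intro c
    rw [typeBCoroot_of_root, smul_dotProduct, dotProduct_smul, typeBRoot_dot]
    rcases typeBNorm_eq n c with hc | hc <;> simp [hc]
  have hN : typeBNorm n a = typeBNorm n b := by
    have ha := hsq a
    have hb := hsq b
    rw [h] at ha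
    rcases typeBNorm_eq n a with h1 | h1 <;> rcases typeBNorm_eq n b with h2 | h2 <;>
      rw [h1] at ha <;> rw [h2] at hb <;> omega
  apply typeBRoot_injective n
  rw [typeBCoroot_of_root, typeBCoroot_of_root, hN] at h
  split_ifs at h
  · exact smul_right_injective _ two_ne_zero h
  · simpa using h

theorem typeB_reflect_dot (n : ℕ) (a : TypeBIndex n) (x : Fin n → ℤ) :
    (x - (x ⬝ᵥ typeBCoroot n a) • typeBRoot n a) ⬝ᵥ
      (x - (x ⬝ᵥ typeBCoroot n a) • typeBRoot n a) = x ⬝ᵥ x := by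
  rw [typeBCoroot_of_root]
  simp only [sub_dotProduct, dotProduct_sub, smul_dotProduct, dotProduct_smul, typeBRoot_dot,
    dotProduct_comm (typeBRoot n a) x, smul_eq_mul]
  rcases typeBNorm_eq n a with h | h <;> simp [h] <;> ring

theorem typeB_reflect (n : ℕ) (a b : TypeBIndex n) :
    ∃ c, typeBRoot n c = typeBRoot n b - (typeBRoot n b ⬝ᵥ typeBCoroot n a) • typeBRoot n a ∧
      typeBNorm n c = typeBNorm n b := by
  have h := typeB_reflect_dot n a (typeBRoot n b)
  obtain ⟨c, hc⟩ := exists_typeBRoot n _ (by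
    rw [h, typeBRoot_dot]
    exact typeBNorm_eq n b)
  refine ⟨c, hc, ?_⟩
  rw [← hc, typeBRoot_dot, typeBRoot_dot] at h
  exact h

/-- The root datum with `X = Y = ℤⁿ`, the standard pairing, and roots of type `Bₙ`. -/
def typeBDatum (n : ℕ) : RootDatum (TypeBIndex n) (Fin n → ℤ) (Fin n → ℤ) :=
  RootPairing.mk' (dotProductEquiv ℤ (Fin n)).toLinearMap
    ⟨typeBRoot n, typeBRoot_injective n⟩ ⟨typeBCoroot n, typeBCoroot_injective n⟩
    (by
      intro a
      change typeBRoot n a ⬝ᵥ typeBCoroot n a = 2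
      rw [typeBCoroot_of_root, dotProduct_smul, typeBRoot_dot]
      rcases typeBNorm_eq n a with h | h <;> simp [h])
    (by
      rintro a - ⟨b, rfl⟩
      obtain ⟨c, hc, -⟩ := typeB_reflect n a b
      exact ⟨c, hc⟩)
    (by
      rintro a - ⟨b, rfl⟩
      obtain ⟨c, hc, hN⟩ := typeB_reflect n a b
      refine ⟨c, ?_⟩
      change typeBCoroot n c =
        typeBCoroot n b - (typeBRoot n a ⬝ᵥ typeBCoroot n b) • typeBCoroot n a
      rw [typeBCoroot_of_root n c, hc, hN]
      simp only [typeBCoroot_of_root n b, typeBCoroot_of_root n a, dotProduct_smul, smul_sub,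
        smul_smul, dotProduct_comm (typeBRoot n a) (typeBRoot n b), smul_eq_mul]
      congr 2
      ring)

theorem typeBNorm_reflectionPerm (n : ℕ) (a b : TypeBIndex n) :
    typeBNorm n ((typeBDatum n).reflectionPerm a b) = typeBNorm n b := by
  obtain ⟨c, hc, hN⟩ := typeB_reflect n a b
  have h : typeBRoot n b - (typeBRoot n b ⬝ᵥ typeBCoroot n a) • typeBRoot n a =
      typeBRoot n ((typeBDatum n).reflectionPerm a b) := (typeBDatum n).reflectionPerm_root a b
  rw [← typeBRoot_injective n (hc.trans h), hN]

/-- The normalised affine Hecke algebra `ℋⁿ_{m₋,m₊}` of type `Bₙ` with base `q ^ b`: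
`m₋(tᵢtⱼ^±) = 0`, `m₊(tᵢtⱼ^±) = b`, `m₋(tᵢ) = b m₋`, `m₊(tᵢ) = b m₊`. In terms of affine roots,
`m_R = b` on those over `tᵢtⱼ^±`, and on those over `tᵢ` it is `b (m₊ + m₋)` or `b (m₊ - m₋)`
at even or odd height. It is used only if the last two numbers are integers, and then the floors
do nothing. -/
def typeBHecke (n : ℕ) (b : ℤ) (mMinus mPlus : ℚ) (d : ℝ → ℝ) :
    NormalizedHecke (TypeBIndex n) n where
  datum := typeBDatum n
  mR a k :=
    if typeBNorm n a = 2 then b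
    else if Even k then ⌊(b : ℚ) * (mPlus + mMinus)⌋ else ⌊(b : ℚ) * (mPlus - mMinus)⌋
  mR_translation := by
    intro a k x
    rcases a with ⟨i, e⟩ | a
    · have h : (typeBDatum n).toLinearMap x ((typeBDatum n).coroot (.inl (i, e))) =
          x ⬝ᵥ Pi.single i (2 * (e : ℤ)) := rfl
      rw [h, dotProduct_single, mul_left_comm]
      simp [Int.even_add]
    · simp [typeBNorm]
  mR_reflection := by
    intro a b' k
    simp only [typeBNorm_reflectionPerm]
  d := d

/-! ### The extra-special parameters -/

/-- `m ∈ ℤ ± 1/4`. -/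
def IsQuarter (m : ℚ) : Prop := ∃ k : ℤ, m = k + 1 / 4 ∨ m = k - 1 / 4

/-- The integer `κ ≥ 0` in `|m| = κ + (2ε - 1)/4`, for `m ∈ ℤ ± 1/4`. -/
def kappa (m : ℚ) : ℕ := ⌊|m| + 1 / 2⌋₊

/-- The number `ε ∈ {0, 1}` in `|m| = κ + (2ε - 1)/4`, for `m ∈ ℤ ± 1/4`. -/
def eps (m : ℚ) : ℕ := if (kappa m : ℚ) < |m| then 1 else 0

/-- The parity `δ ∈ {0, 1}` of `κ`. -/
def delta (m : ℚ) : ℕ := kappa m % 2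

theorem kappa_of_abs_one (m : ℚ) (k : ℕ) (h : |m| = k + 1 / 4) : kappa m = k ∧ eps m = 1 := by
  have hk : kappa m = k := by
    rw [kappa, h, Nat.floor_eq_iff (by positivity)]
    constructor <;> linarith
  refine ⟨hk, ?_⟩
  rw [eps, hk, h, if_pos (by linarith)]

theorem kappa_of_abs_three (m : ℚ) (k : ℕ) (h : |m| = k + 3 / 4) :
    kappa m = k + 1 ∧ eps m = 0 := by
  have hk : kappa m = k + 1 := by
    rw [kappa, h, Nat.floor_eq_iff (by positivity)]
    constructor <;> push_cast <;> linarith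
  refine ⟨hk, ?_⟩
  rw [eps, hk, h, if_neg (by push_cast; linarith)]

theorem IsQuarter.exists_abs (m : ℚ) (h : IsQuarter m) :
    ∃ k : ℕ, |m| = k + 1 / 4 ∨ |m| = k + 3 / 4 := by
  have key : ∀ x : ℚ, 0 ≤ x → IsQuarter x → ∃ k : ℕ, x = k + 1 / 4 ∨ x = k + 3 / 4 := by
    rintro x hx ⟨k, rfl | rfl⟩
    · have hk : 0 ≤ k := by
        have : (-1 : ℚ) < k := by linarith
        have : -1 < k := by exact_mod_cast this
        omega
      obtain ⟨k, rfl⟩ := Int.eq_ofNat_of_zero_le hk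
      exact ⟨k, Or.inl (by simp)⟩
    · have hk : 0 ≤ k - 1 := by
        have : (0 : ℚ) < k := by linarith
        have : 0 < k := by exact_mod_cast this
        omega
      obtain ⟨j, hj⟩ := Int.eq_ofNat_of_zero_le hk
      obtain rfl : k = j + 1 := by omega
      refine ⟨j, Or.inr ?_⟩
      push_cast
      ring
  apply key _ (abs_nonneg m)
  rcases abs_choice m with h1 | h1 <;> rw [h1]
  · exact h
  · obtain ⟨k, hk | hk⟩ := h
    · exact ⟨-k, Or.inr (by rw [hk]; push_cast; ring)⟩
    · exact ⟨-k, Or.inl (by rw [hk]; push_cast; ring)⟩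

theorem abs_eq_kappa_add (m : ℚ) (h : IsQuarter m) :
    |m| = kappa m + (2 * eps m - 1) / 4 := by
  obtain ⟨k, hk | hk⟩ := h.exists_abs
  · obtain ⟨h1, h2⟩ := kappa_of_abs_one m k hk
    rw [h1, h2, hk]
    norm_num
  · obtain ⟨h1, h2⟩ := kappa_of_abs_three m k hk
    rw [h1, h2, hk]
    push_cast
    ring

/-- `σₑ(m) = (q^δ, q^(δ+1), …, q^(2m - 3/2))` for `m > 1`, with `q = v ^ 2`. -/
def sigmaE (v : Param) (m : ℚ) : List ℂˣ :=
  (List.range' (delta m) (⌊2 * m - 3 / 2⌋₊ + 1 - delta m)).map fun k => (v.unit ^ 2) ^ k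

/-- `rₑ(m) = (σₑ(m); rₑ(m - 1))` if `m > 1`, and `rₑ(1/4) = rₑ(3/4) = ∅`. -/
def rE (v : Param) (m : ℚ) : List ℂˣ :=
  if 1 < m then sigmaE v m ++ rE v (m - 1) else []
termination_by ⌊m⌋₊
decreasing_by
  rw [Nat.floor_sub_one]
  have : 1 ≤ ⌊m⌋₊ := Nat.le_floor (by push_cast; linarith)
  omega

/-- `l_± = κ (κ + ε - 1/2)`. -/
def lPart (m : ℚ) : ℚ := kappa m * (kappa m + eps m - 1 / 2)

/-- The rank `l = 2r + ⌊l₋⌋ + ⌊l₊⌋` of the target. -/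
def targetRank (r : ℕ) (mMinus mPlus : ℚ) : ℕ := 2 * r + ⌊lPart mMinus⌋₊ + ⌊lPart mPlus⌋₊

/-- The coordinates `(-rₑ(m₋), v⁻¹s₁, vs₁, …, v⁻¹sᵣ, vsᵣ, rₑ(m₊))`. -/
def xiList (r : ℕ) (mMinus mPlus : ℚ) (v : Param) (s : Torus r) : List ℂˣ :=
  (rE v mMinus).map (fun x => -x) ++
    (List.ofFn s).flatMap (fun x => [v.unit⁻¹ * x, v.unit * x]) ++ rE v mPlus

theorem length_rE_one (v : Param) (k : ℕ) :
    (rE v (k + 1 / 4)).length = k * (2 * k + 1) / 2 := by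
  induction k with
  | zero => rw [rE, if_neg (by norm_num)]; simp
  | succ k ih =>
    have h1 : ((k + 1 : ℕ) : ℚ) + 1 / 4 - 1 = k + 1 / 4 := by push_cast; ring
    have hk := (kappa_of_abs_one ((k + 1 : ℕ) + 1 / 4) (k + 1) (abs_of_pos (by positivity))).1
    have hf : ⌊2 * (((k + 1 : ℕ) : ℚ) + 1 / 4) - 3 / 2⌋₊ = 2 * k + 1 := by
      rw [show 2 * (((k + 1 : ℕ) : ℚ) + 1 / 4) - 3 / 2 = (2 * k + 1 : ℕ) by push_cast; ring]
      exact Nat.floor_natCast _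
    have h2 : (1 : ℚ) < (k + 1 : ℕ) + 1 / 4 := by
      push_cast
      linarith [(Nat.cast_nonneg k : (0 : ℚ) ≤ k)]
    rw [rE, if_pos h2, List.length_append, h1, ih, sigmaE, List.length_map, List.length_range', hf,
      delta, hk]
    obtain ⟨j, rfl | rfl⟩ := Nat.even_or_odd' k <;> ring_nf <;> omega

theorem length_rE_three (v : Param) (k : ℕ) :
    (rE v (k + 3 / 4)).length = (k + 1) * (2 * k + 1) / 2 := by
  induction k with
  | zero => rw [rE, if_neg (by norm_num)]; simp
  | succ k ih =>
    have h1 : ((k + 1 : ℕ) : ℚ) + 3 / 4 - 1 = k + 3 / 4 := by push_cast; ring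
    have hk := (kappa_of_abs_three ((k + 1 : ℕ) + 3 / 4) (k + 1) (abs_of_pos (by positivity))).1
    have hf : ⌊2 * (((k + 1 : ℕ) : ℚ) + 3 / 4) - 3 / 2⌋₊ = 2 * k + 2 := by
      rw [show 2 * (((k + 1 : ℕ) : ℚ) + 3 / 4) - 3 / 2 = (2 * k + 2 : ℕ) by push_cast; ring]
      exact Nat.floor_natCast _
    have h2 : (1 : ℚ) < (k + 1 : ℕ) + 3 / 4 := by
      push_cast
      linarith [(Nat.cast_nonneg k : (0 : ℚ) ≤ k)]
    rw [rE, if_pos h2, List.length_append, h1, ih, sigmaE, List.length_map, List.length_range', hf,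
      delta, hk]
    obtain ⟨j, rfl | rfl⟩ := Nat.even_or_odd' k <;> ring_nf <;> omega

theorem length_rE (v : Param) (m : ℚ) (h : IsQuarter m) (h0 : 0 < m) :
    (rE v m).length = ⌊lPart m⌋₊ := by
  obtain ⟨k, hk | hk⟩ := h.exists_abs
  · obtain ⟨h1, h2⟩ := kappa_of_abs_one m k hk
    have h3 : lPart m = ((k * (2 * k + 1) : ℕ) : ℚ) / (2 : ℕ) := by
      rw [lPart, h1, h2]
      push_cast
      ring
    rw [h3, Nat.floor_div_eq_div, ← abs_of_pos h0, hk, length_rE_one]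
  · obtain ⟨h1, h2⟩ := kappa_of_abs_three m k hk
    have h3 : lPart m = (((k + 1) * (2 * k + 1) : ℕ) : ℚ) / (2 : ℕ) := by
      rw [lPart, h1, h2]
      push_cast
      ring
    rw [h3, Nat.floor_div_eq_div, ← abs_of_pos h0, hk, length_rE_three]

theorem length_xiList (r : ℕ) (mMinus mPlus : ℚ) (hMinus : IsQuarter mMinus)
    (hPlus : IsQuarter mPlus) (hMinus0 : 0 < mMinus) (hPlus0 : 0 < mPlus)
    (v : Param) (s : Torus r) :
    (xiList r mMinus mPlus v s).length = targetRank r mMinus mPlus := by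
  simp only [xiList, targetRank, List.length_append, List.length_map, List.length_flatMap,
    length_rE v _ hMinus hMinus0, length_rE v _ hPlus hPlus0, List.length_cons, List.length_nil,
    List.map_const', List.sum_replicate, List.length_ofFn, smul_eq_mul]
  ring

/-- The morphism `ξ`, with coordinates `xiList` (whose length is `targetRank r mMinus mPlus` by
`length_xiList`, so that the default value is not used). -/
def xi (r : ℕ) (mMinus mPlus : ℚ) (v : Param) (s : Torus r) :
    Torus (targetRank r mMinus mPlus) :=
  fun i => (xiList r mMinus mPlus v s).getD i 1

/-- The rank zero normalising factor
`d⁰ = ∏_{i=1}^{⌊|m₋-m₊|⌋} (v^(2|m₋-m₊|-2i) / (1 + q^(2|m₋-m₊|-2i)))^i`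
`∏_{j=1}^{⌊m₋+m₊⌋} (v^(2|m₋+m₊|-2j) / (1 + q^(2|m₋+m₊|-2j)))^j`.
The numbers `2|m₋ ± m₊|` are integers for `m₋, m₊ ∈ ℤ ± 1/4`. -/
def dZero (mMinus mPlus : ℚ) (v : ℝ) : ℝ :=
  (∏ i ∈ Finset.Icc 1 ⌊|mMinus - mPlus|⌋₊,
      (v ^ (⌊2 * |mMinus - mPlus|⌋ - 2 * i) /
        (1 + (v ^ 2) ^ (⌊2 * |mMinus - mPlus|⌋ - 2 * i))) ^ i) *
    ∏ j ∈ Finset.Icc 1 ⌊|mMinus + mPlus|⌋₊,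
      (v ^ (⌊2 * |mMinus + mPlus|⌋ - 2 * j) /
        (1 + (v ^ 2) ^ (⌊2 * |mMinus + mPlus|⌋ - 2 * j))) ^ j

/-- The source: rank `r`, parameters `(m₋, m₊)`, base `q ^ 2`, and
`d = (v² - v⁻²)^(-r) d⁰`. -/
def sourceHecke (r : ℕ) (mMinus mPlus : ℚ) : NormalizedHecke (TypeBIndex r) r :=
  typeBHecke r 2 mMinus mPlus fun v => ((v ^ 2 - (v ^ 2)⁻¹) ^ r)⁻¹ * dZero mMinus mPlus v

/-- The target: rank `l`, parameters `(δ₋, δ₊)`, base `q`, and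
`d = (v - v⁻¹)^(-l) (v + v⁻¹)^(-δ₋ δ₊)`. -/
def targetHecke (l dMinus dPlus : ℕ) : NormalizedHecke (TypeBIndex l) l :=
  typeBHecke l 1 dMinus dPlus fun v => ((v - v⁻¹) ^ l)⁻¹ * ((v + v⁻¹) ^ (dMinus * dPlus))⁻¹

end

end AffHecke

/-! Residuality of the image and the identity of `μ`-functions are two instances of one identity.
Both concern sums over the roots of `φ(-α) + φ(α) - φ(-α v^(2m₋)) - φ(α v^(2m₊))`, taken over formal
monomials `± v^k s^χ` (`muSum`). For residuality `φ` counts trivial monomials (`isOne`). For `μ` it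
is the factor `g^(1/2) - g^(-1/2)`, replaced by `1` if `g` is trivial, taken modulo rational
constants and written additively (`symClass`). In both cases `φ(g⁻¹) = φ(g)` and `φ(g²) = φ(g) +
φ(-g)`, the latter reflecting `1 - g² = (1 - g)(1 + g)`. So it suffices to prove `muSum_target` for
every `φ` with these two symmetries.

Extended additively to the group ring, such a `φ` kills antisymmetric elements and all `ψ²P - P -
ηP`, where `η = -1` and `ψ²` is the Adams operation. If `C` is the character of the short roots in
rank `l`, that of the long roots is `Λ²C - l` with `Λ²C = (C² - ψ²C)/2`. On the image, `C = ηA + (v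
+ v⁻¹)s + B`, where `A`, `B` come from `rₑ(m₋)`, `rₑ(m₊)` and `s` is the character of the short
roots of the source. The recursion for `rₑ` telescopes to `(U² - 4) U (A + δ₋) = v^M + v^(-M) - U`
with `U = v + v⁻¹` and `M = 4m₋`, and likewise for `B` (`exists_exponentList`).

After expansion, the coefficients of `s`, `ηs` and `Λ²s` in the difference of the two sides are
antisymmetric by these closed forms. The part involving only `v` and `η`, which contains the rank
zero normalising factor, reduces to an identity of rational functions in `U`, `v^M + v^(-M)` and
`v^(M') + v^(-M')`, where `M' = 4m₊` (`const_identity`). These pieces are assembled in `lin_muChar`.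

For the counting function the source contributes nothing, and the identity gives the codimension `l
- r`. For the symmetric factors it gives the `μ`-identity at generic points, which extends to all
points by density. The other conditions hold because `ξ` is a monomial map having every unit vector
among its exponents, hence a closed embedding, and because the constants in `v⁻¹sⱼ`, `vsⱼ` cancel in
pairs. -/

namespace AffHecke

noncomputable section

/-! ### Formal characters -/

/-- The ring of formal characters `ℤ[Γ]`. -/
abbrev FormalChar (Γ : Type) : Type := MonoidAlgebra ℤ Γ

namespace FormalChar

section

variable {Γ G : Type} [AddCommGroup G]

/-- The basis element of a group element. -/
def mon (g : Γ) : FormalChar Γ := MonoidAlgebra.single g 1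

/-- The additive extension of a function on `Γ`. -/
def lin (φ : Γ → G) : FormalChar Γ →+ G :=
  (Finsupp.liftAddHom fun g => zmultiplesHom G (φ g)).comp
    (MonoidAlgebra.coeffAddEquiv (R := ℤ) (M := Γ)).toAddMonoidHom

theorem lin_apply (φ : Γ → G) (P : FormalChar Γ) :
    lin φ P = ∑ g ∈ P.coeff.support, P.coeff g • φ g := by
  simp [lin, Finsupp.sum]

@[simp]
theorem lin_mon (φ : Γ → G) (g : Γ) : lin φ (mon g) = φ g := by
  simp [lin, mon]

end

variable {Γ Δ G : Type} [CommGroup Γ] [CommGroup Δ] [AddCommGroup G]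

theorem mon_one : mon (1 : Γ) = 1 := rfl

theorem mon_mul (g h : Γ) : mon (g * h) = mon g * mon h := by
  simp [mon, MonoidAlgebra.single_mul_single]

theorem mon_mul_inv (g : Γ) : mon g * mon g⁻¹ = 1 := by
  rw [← mon_mul, mul_inv_cancel, mon_one]

/-- The ring homomorphism induced by a homomorphism of groups. -/
def mapHom (f : Γ →* Δ) : FormalChar Γ →+* FormalChar Δ := MonoidAlgebra.mapDomainRingHom ℤ f

@[simp]
theorem mapHom_mon (f : Γ →* Δ) (g : Γ) : mapHom f (mon g) = mon (f g) := by
  simp [mapHom, mon]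

/-- Two additive maps that agree on the basis elements are equal. -/
theorem addHom_ext {f f' : FormalChar Γ →+ G} (h : ∀ g, f (mon g) = f' (mon g)) : f = f' := by
  refine MonoidAlgebra.addMonoidHom_ext fun g n => ?_
  have hn : (MonoidAlgebra.single g n : FormalChar Γ) = n • mon g := by
    simp [mon]
  rw [hn, map_zsmul, map_zsmul, h]

/-- The duality `g ↦ g⁻¹`. -/
def dual : FormalChar Γ →+* FormalChar Γ := mapHom invMonoidHom

/-- The Adams operation `g ↦ g²`. -/
def adams : FormalChar Γ →+* FormalChar Γ := mapHom (powMonoidHom 2)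

@[simp]
theorem dual_mon (g : Γ) : dual (mon g) = mon g⁻¹ := by simp [dual]

@[simp]
theorem adams_mon (g : Γ) : adams (mon g) = mon (g ^ 2) := by simp [adams]

theorem mapHom_dual (f : Γ →* Δ) (P : FormalChar Γ) : mapHom f (dual P) = dual (mapHom f P) := by
  refine DFunLike.congr_fun (f := ((mapHom f).comp dual).toAddMonoidHom)
    (g := (dual.comp (mapHom f)).toAddMonoidHom) (addHom_ext fun g => ?_) P
  simp

theorem mapHom_adams (f : Γ →* Δ) (P : FormalChar Γ) :
    mapHom f (adams P) = adams (mapHom f P) := by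
  refine DFunLike.congr_fun (f := ((mapHom f).comp adams).toAddMonoidHom)
    (g := (adams.comp (mapHom f)).toAddMonoidHom) (addHom_ext fun g => ?_) P
  simp

theorem dual_adams (P : FormalChar Γ) : dual (adams P) = adams (dual P) := mapHom_adams _ P

theorem coeff_dual (P : FormalChar Γ) (g : Γ) : (dual P).coeff g = P.coeff g⁻¹ := by
  have h := Finsupp.mapDomain_apply (M := ℤ) (inv_injective (G := Γ)) P.coeff g⁻¹
  rw [inv_inv] at h
  exact h

/-- A function with `φ(g⁻¹) = φ(g)` vanishes on antisymmetric elements. -/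
theorem lin_eq_zero {φ : Γ → G} (hφ : ∀ g, φ g⁻¹ = φ g) {P : FormalChar Γ}
    (h : P + dual P = 0) : lin φ P = 0 := by
  have hc : ∀ g, P.coeff g⁻¹ = -P.coeff g := fun g => by
    have := congrArg (fun Q : FormalChar Γ => Q.coeff g) h
    simp only [MonoidAlgebra.coeff_add, Finsupp.add_apply, coeff_dual, MonoidAlgebra.coeff_zero,
      Finsupp.coe_zero, Pi.zero_apply] at this
    omega
  rw [lin_apply]
  -- The terms at `g` and `g⁻¹` cancel; at a fixed point of the inversion the coefficient is its own
  -- negative, hence zero.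
  refine Finset.sum_involution (fun g _ => g⁻¹) ?_ ?_ ?_ ?_
  · intro g _
    rw [hc, hφ, neg_smul, add_neg_cancel]
  · intro g _ hg heq
    have := hc g
    rw [heq] at this
    apply hg
    rw [show P.coeff g = 0 by omega, zero_smul]
  · intro g hg
    simpa [hc] using hg
  · intro g _
    exact inv_inv g

/-- This is the device that removes `η`: under `φ`, an element `ηP` may be replaced by `ψ²P - P`. -/
theorem lin_adams {φ : Γ → G} {η : Γ} (hφ : ∀ g, φ (g ^ 2) = φ g + φ (η * g))
    (P : FormalChar Γ) : lin φ (adams P) = lin φ P + lin φ (mon η * P) := by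
  refine DFunLike.congr_fun (f := (lin φ).comp adams.toAddMonoidHom)
    (g := lin φ + (lin φ).comp (AddMonoidHom.mulLeft (mon η))) (addHom_ext fun g => ?_) P
  simp [hφ, ← mon_mul]

theorem two_mul_cancel {P Q : FormalChar Γ} (h : 2 * P = 2 * Q) : P = Q := by
  ext g
  have := congrArg (fun Q : FormalChar Γ => Q.coeff g) h
  simp only [two_mul, MonoidAlgebra.coeff_add, Finsupp.add_apply] at this
  omega

/-- The square of a character is congruent to its Adams operation modulo `2`. -/
theorem exists_half (P : FormalChar Γ) : ∃ X, 2 * X = P ^ 2 - adams P := by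
  induction P using MonoidAlgebra.induction_linear with
  | zero => exact ⟨0, by simp⟩
  | add P Q hP hQ =>
    obtain ⟨X, hX⟩ := hP
    obtain ⟨Y, hY⟩ := hQ
    refine ⟨X + Y + P * Q, ?_⟩
    rw [map_add]
    linear_combination hX + hY
  | single g n =>
    have hn : (MonoidAlgebra.single g n : FormalChar Γ) = (n : FormalChar Γ) * mon g := by
      rw [← zsmul_eq_mul]
      simp [mon]
    -- For a single term `n g` the difference is `n² g² - n g²`, so the parity of `n (n - 1)` is
    -- what matters.
    obtain ⟨k, hk⟩ : Even (n * (n - 1)) := Int.even_mul_pred_self n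
    refine ⟨k * mon (g ^ 2), ?_⟩
    have hk' : (n : FormalChar Γ) * (n - 1) = k + k := by exact_mod_cast congrArg Int.cast hk
    rw [hn, map_mul, map_intCast, adams_mon, pow_two g, mon_mul]
    linear_combination (-mon g * mon g) * hk'

/-- The sum of the weights `g^{±1}` of a list. -/
def ch (l : List Γ) : FormalChar Γ := (l.map fun g => mon g + mon g⁻¹).sum

theorem ch_append (l l' : List Γ) : ch (l ++ l') = ch l + ch l' := by simp [ch]

@[simp]
theorem ch_nil : ch ([] : List Γ) = 0 := rfl

@[simp]
theorem ch_cons (g : Γ) (l : List Γ) : ch (g :: l) = mon g + mon g⁻¹ + ch l := by simp [ch]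

theorem dual_ch (l : List Γ) : dual (ch l) = ch l := by
  induction l with
  | nil => simp
  | cons g l ih => simp [ih, add_comm]

theorem mapHom_ch (f : Γ →* Δ) (l : List Γ) : mapHom f (ch l) = ch (l.map f) := by
  induction l with
  | nil => simp
  | cons g l ih => simp [ih]

theorem mon_mul_ch {η : Γ} (hη : η ^ 2 = 1) (l : List Γ) :
    mon η * ch l = ch (l.map (η * ·)) := by
  have h : η⁻¹ = η := inv_eq_of_mul_eq_one_left (by rw [← pow_two, hη])
  induction l with
  | nil => simp
  | cons g l ih => simp [mul_add, ih, ← mon_mul, h, mul_comm g⁻¹]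

theorem ch_flatMap_pair (y : Γ) (l : List Γ) :
    ch (l.flatMap fun g => [y⁻¹ * g, y * g]) = (mon y + mon y⁻¹) * ch l := by
  induction l with
  | nil => simp
  | cons g l ih =>
    simp only [List.flatMap_cons, ch_append, ch_cons, ch_nil, ih, mul_inv, inv_inv, mon_mul]
    ring

end FormalChar

end

end AffHecke

namespace AffHecke

noncomputable section

namespace FormalChar

/-! ### Laurent polynomials in one variable -/

/-- The group ring of `ℤ`, i.e. Laurent polynomials. -/
abbrev Laurent : Type := FormalChar (Multiplicative ℤ)

/-- The monomial `y ^ k`. -/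
def ypow (k : ℤ) : Laurent := mon (Multiplicative.ofAdd k)

theorem ypow_zero : ypow 0 = 1 := rfl

theorem ypow_add (a b : ℤ) : ypow (a + b) = ypow a * ypow b := by
  rw [ypow, ofAdd_add, mon_mul]
  rfl

@[simp]
theorem dual_ypow (k : ℤ) : dual (ypow k) = ypow (-k) := by simp [ypow]

@[simp]
theorem adams_ypow (k : ℤ) : adams (ypow k) = ypow (2 * k) := by
  simp [ypow, ← ofAdd_nsmul]

/-- `y ^ k + y ^ (-k)`. -/
def ysym (k : ℤ) : Laurent := ypow k + ypow (-k)

theorem dual_ysym (k : ℤ) : dual (ysym k) = ysym k := by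
  simp [ysym, add_comm]

theorem adams_ysym (k : ℤ) : adams (ysym k) = ysym (2 * k) := by
  simp [ysym]

theorem ysym_neg (k : ℤ) : ysym (-k) = ysym k := by
  simp [ysym, add_comm]

theorem ysym_zero : ysym 0 = 2 := by
  rw [ysym, neg_zero, ypow_zero]
  norm_num

theorem ysym_mul (a b : ℤ) : ysym a * ysym b = ysym (a + b) + ysym (a - b) := by
  simp only [ysym, sub_eq_add_neg, neg_add, ypow_add, neg_neg]
  ring

theorem ysym_two_mul (k : ℤ) : ysym (2 * k) = ysym k ^ 2 - 2 := by
  rw [pow_two, ysym_mul, sub_self, ysym_zero, two_mul]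
  ring

theorem ysym_ne_zero (k : ℤ) : ysym k ≠ 0 := by
  intro h
  have := congrArg (fun P : Laurent => P.coeff (Multiplicative.ofAdd k)) h
  simp only [ysym, ypow, mon, MonoidAlgebra.coeff_add, MonoidAlgebra.coeff_single,
    Finsupp.add_apply, Finsupp.single_apply, if_true] at this
  split_ifs at this <;> simp at this

theorem ysym_one_sq_sub_ne_zero : ysym 1 ^ 2 - 4 ≠ 0 := by
  intro h
  have h2 : ysym 2 - 2 = 0 := by
    rw [show (2 : ℤ) = 2 * 1 from rfl, ysym_two_mul]
    linear_combination h
  have := congrArg (fun P : Laurent => P.coeff (Multiplicative.ofAdd 2)) h2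
  have e2 : (2 : Laurent) = (2 : ℤ) • mon (Multiplicative.ofAdd 0) := by
    rw [ofAdd_zero, mon_one]
    norm_num
  rw [e2] at this
  simp only [ysym, ypow, mon, MonoidAlgebra.coeff_add, MonoidAlgebra.coeff_sub,
    MonoidAlgebra.coeff_smul, MonoidAlgebra.coeff_single, Finsupp.add_apply, Finsupp.sub_apply,
    Finsupp.smul_apply, Finsupp.single_apply, if_true, Multiplicative.ofAdd.injective.eq_iff]
    at this
  norm_num at this

/-- The exponents of `q = y²` in a list of natural numbers. -/
def qList (l : List ℕ) : List (Multiplicative ℤ) :=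
  l.map fun k : ℕ => Multiplicative.ofAdd (2 * (k : ℤ))

/-- Multiplication by `y - y⁻¹` makes the geometric sum over consecutive powers of `q = y²`
telescope, leaving only the boundary terms. -/
theorem ch_qList_range' (a n : ℕ) :
    (ypow 1 - ypow (-1)) * ch (qList (List.range' a n)) =
      ypow (2 * (a + n) - 1) - ypow (1 - 2 * (a + n)) - (ypow (2 * a - 1) - ypow (1 - 2 * a)) := by
  induction n with
  | zero => simp [qList]
  | succ n ih =>
    rw [List.range'_concat, qList, List.map_append, ch_append, mul_add]
    rw [qList] at ih
    rw [ih]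
    have h : ch (List.map (fun k : ℕ => Multiplicative.ofAdd (2 * (k : ℤ))) [a + 1 * n]) =
        ypow (2 * (a + n)) + ypow (-(2 * (a + n))) := by
      simp only [List.map_cons, List.map_nil, ch_cons, ch_nil, add_zero, one_mul, ypow, ofAdd_neg,
        Nat.cast_add]
    rw [h]
    simp only [mul_add, sub_mul, ← ypow_add]
    push_cast
    ring_nf


/-- With `k = 4m - 2` the right side is the increment of `y^(4m) + y^(-4m)` in the step from `m - 1`
to `m`. -/
theorem ysym_one_mul_ypow_sub (k : ℤ) :
    (ypow 1 - ypow (-1)) * ysym 1 * (ypow k - ypow (-k)) = ysym (k + 2) - ysym (k - 2) := by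
  simp only [ysym, sub_mul, mul_sub, add_mul, mul_add, ← ypow_add]
  ring_nf

theorem ypow_sub_sq : (ypow 1 - ypow (-1)) ^ 2 = ysym 1 ^ 2 - 4 := by
  have h : ypow 1 * ypow (-1) = 1 := by rw [← ypow_add, add_neg_cancel, ypow_zero]
  rw [ysym]
  linear_combination (-4) * h

theorem ysym_three : ysym 3 = ysym 1 ^ 3 - 3 * ysym 1 := by
  have h := ysym_mul 2 1
  rw [show (2 : ℤ) = 2 * 1 from rfl, ysym_two_mul] at h
  norm_num at h
  linear_combination -h

/-- `l` is the list of exponents of `q` in `rₑ(m)`, and its character has the expected closed form,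
where `M = 4 m`. -/
def IsExponentList (m : ℚ) (M : ℕ) (l : List ℕ) : Prop :=
  (∀ v, rE v m = l.map fun k => (v.unit ^ 2) ^ k) ∧
    (ysym 1 ^ 2 - 4) * ysym 1 * (ch (qList l) + delta m) = ysym M - ysym 1

/-- The string `σₑ(m)` runs over the exponents `δ, …, N`. The upper ends of its telescoped sum give
the increment from `M' = 4m'` to `M = 4m`. The lower ends give `2δ - 1` times `y - y⁻¹`, which,
because the parities satisfy `δ' + δ = 1`, turns the correction `δ'` of the shorter list into `δ`.
-/
theorem IsExponentList.step {m m' : ℚ} {N M M' : ℕ} {l : List ℕ} (hm : 1 < m) (hm' : m - 1 = m')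
    (hN : 2 * m - 3 / 2 = N) (hM : M = 2 * N + 3) (hM' : M' + 1 = 2 * N)
    (hδ : delta m' + delta m = 1) (h : IsExponentList m' M' l) :
    ∃ l', IsExponentList m M l' := by
  refine ⟨List.range' (delta m) (N + 1 - delta m) ++ l, fun v => ?_, ?_⟩
  · rw [rE, if_pos hm, hm', h.1, sigmaE, hN, Nat.floor_natCast, List.map_append]
  have hl := h.2
  rw [qList, List.map_append, ch_append, ← qList, ← qList]
  have h1 := ch_qList_range' (delta m) (N + 1 - delta m)
  have h3 := ysym_one_mul_ypow_sub (2 * N + 1)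
  rw [show (2 * (N : ℤ) + 1 - 2) = M' by omega, show (2 * (N : ℤ) + 1 + 2) = M by omega] at h3
  rw [show (2 * (delta m + ((N + 1 - delta m : ℕ) : ℤ)) - 1) = 2 * N + 1 by omega,
    show (1 - 2 * (delta m + ((N + 1 - delta m : ℕ) : ℤ))) = -(2 * N + 1) by omega] at h1
  have h4 : ypow (2 * delta m - 1) - ypow (1 - 2 * delta m) =
      (2 * (delta m : Laurent) - 1) * (ypow 1 - ypow (-1)) := by
    rcases (by omega : delta m = 0 ∨ delta m = 1) with hd | hd <;> rw [hd]
    · norm_num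
    · norm_num
  have h5 : (delta m' : Laurent) + delta m = 1 := by exact_mod_cast congrArg Nat.cast hδ
  linear_combination hl + (ypow 1 - ypow (-1)) * ysym 1 * (h1 - h4) + h3 -
    (ysym 1 * ch (qList (List.range' (delta m) (N + 1 - delta m))) +
      (2 * (delta m : Laurent) - 1) * ysym 1) * ypow_sub_sq - (ysym 1 ^ 2 - 4) * ysym 1 * h5

theorem exists_exponentList_one (k : ℕ) : ∃ l, IsExponentList (k + 1 / 4) (4 * k + 1) l := by
  induction k with
  | zero =>
    refine ⟨[], fun v => ?_, ?_⟩
    · rw [rE, if_neg (by norm_num)]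
      rfl
    · have h := (kappa_of_abs_one (1 / 4) 0 (by norm_num [abs_of_pos])).1
      rw [Nat.cast_zero, zero_add, delta, h]
      simp [qList]
  | succ k ih =>
    obtain ⟨l, hl⟩ := ih
    have h1 := (kappa_of_abs_one (k + 1 / 4) k (abs_of_pos (by positivity))).1
    have h2 := (kappa_of_abs_one ((k + 1 : ℕ) + 1 / 4) (k + 1) (abs_of_pos (by positivity))).1
    have h3 : ((k + 1 : ℕ) : ℚ) + 1 / 4 - 1 = k + 1 / 4 := by push_cast; ring
    refine IsExponentList.step (N := 2 * k + 1) ?_ h3 ?_ (by ring) ?_ ?_ hl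
    · push_cast
      linarith [(Nat.cast_nonneg k : (0 : ℚ) ≤ k)]
    · push_cast
      ring
    · ring
    · rw [delta, delta, h1, h2]
      omega

theorem exists_exponentList_three (k : ℕ) : ∃ l, IsExponentList (k + 3 / 4) (4 * k + 3) l := by
  induction k with
  | zero =>
    refine ⟨[], fun v => ?_, ?_⟩
    · rw [rE, if_neg (by norm_num)]
      rfl
    -- Here `κ = 1`, so `δ = 1` although the list is empty; the closed form becomes `y³ + y⁻³ = U³ -
    -- 3U`.
    · have h := (kappa_of_abs_three (3 / 4) 0 (by norm_num [abs_of_pos])).1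
      rw [Nat.cast_zero, zero_add, delta, h]
      simp [qList, ysym_three]
      ring
  | succ k ih =>
    obtain ⟨l, hl⟩ := ih
    have h1 := (kappa_of_abs_three (k + 3 / 4) k (abs_of_pos (by positivity))).1
    have h2 := (kappa_of_abs_three ((k + 1 : ℕ) + 3 / 4) (k + 1) (abs_of_pos (by positivity))).1
    have h3 : ((k + 1 : ℕ) : ℚ) + 3 / 4 - 1 = k + 3 / 4 := by push_cast; ring
    refine IsExponentList.step (N := 2 * k + 2) ?_ h3 ?_ (by ring) ?_ ?_ hl
    · push_cast
      linarith [(Nat.cast_nonneg k : (0 : ℚ) ≤ k)]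
    · push_cast
      ring
    · ring
    · rw [delta, delta, h1, h2]
      omega

theorem exists_exponentList {m : ℚ} (hm : IsQuarter m) (h0 : 0 < m) :
    ∃ (M : ℕ) (l : List ℕ), (M : ℚ) = 4 * m ∧ Odd M ∧ IsExponentList m M l := by
  obtain ⟨k, hk | hk⟩ := hm.exists_abs
  · rw [abs_of_pos h0] at hk
    obtain ⟨l, hl⟩ := exists_exponentList_one k
    exact ⟨4 * k + 1, l, by rw [hk]; push_cast; ring, ⟨2 * k, by ring⟩, hk ▸ hl⟩
  · rw [abs_of_pos h0] at hk
    obtain ⟨l, hl⟩ := exists_exponentList_three k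
    exact ⟨4 * k + 3, l, by rw [hk]; push_cast; ring, ⟨2 * k + 1, by ring⟩, hk ▸ hl⟩

/-- The sum `∑_{i=1}^{⌊n/2⌋} i y^(2(n-2i))`, which encodes a rank zero normalising factor. -/
def dChar (n : ℕ) : Laurent :=
  ∑ i ∈ Finset.Icc 1 (n / 2), (i : Laurent) * ypow (2 * ((n : ℤ) - 2 * i))

/-- The sum `∑_{i=0}^{⌊n/2⌋} y^(2(n-2i))`. -/
def dStep (n : ℕ) : Laurent := ∑ i ∈ Finset.range (n / 2 + 1), ypow (2 * ((n : ℤ) - 2 * i))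

/-- Passing from `n` to `n + 2` and from `i` to `i + 1` preserves the exponent `2(n - 2i)` and
raises its coefficient by one. -/
theorem dChar_add_two (n : ℕ) : dChar (n + 2) = dChar n + dStep n := by
  have h : ∀ N : ℕ, ∀ f : ℕ → Laurent, ∑ i ∈ Finset.Icc 1 N, f i = ∑ i ∈ Finset.range N, f (i + 1) :=
    fun N f => by rw [Finset.range_eq_Ico, Finset.sum_Ico_add' f 0 N 1]; rfl
  have h2 : dChar n = ∑ i ∈ Finset.range (n / 2 + 1), (i : Laurent) * ypow (2 * ((n : ℤ) - 2 * i)) := by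
    rw [dChar, h, Finset.sum_range_succ']
    simp
  rw [dChar, h, h2, dStep, ← Finset.sum_add_distrib, show (n + 2) / 2 = n / 2 + 1 by omega]
  refine Finset.sum_congr rfl fun i _ => ?_
  push_cast
  rw [show 2 * ((n : ℤ) + 2 - 2 * (i + 1)) = 2 * (n - 2 * i) by ring]
  ring

/-- A geometric sum of ratio `y⁻⁴`, whose smallest exponent is `0` or `2` according to the parity of
`n`. -/
theorem dStep_mul (n : ℕ) :
    dStep n * (ypow 4 - 1) = ypow (2 * n + 4) - ypow (if Even n then 0 else 2) := by
  have h : ∀ N : ℕ, (∑ i ∈ Finset.range N, ypow (2 * ((n : ℤ) - 2 * i))) * (ypow 4 - 1) =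
      ypow (2 * n + 4) - ypow (2 * n + 4 - 4 * N) := by
    intro N
    induction N with
    | zero => simp
    | succ N ih =>
      rw [Finset.sum_range_succ, add_mul, ih, mul_sub, ← ypow_add]
      push_cast
      ring_nf
  rw [dStep, h]
  congr 2
  split_ifs with hn
  · obtain ⟨k, rfl⟩ := hn
    omega
  · obtain ⟨k, rfl⟩ := Nat.not_even_iff_odd.mp hn
    omega

/-- The closed form of the symmetrisation of `dChar`, up to constants. -/
theorem exists_dChar (n : ℕ) : ∃ (K : Laurent) (c : ℤ), dChar n + dual (dChar n) = K + c ∧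
    (ysym 4 - 2) * K = ysym (2 * n) - if Even n then 2 else ysym 2 := by
  induction n using Nat.twoStepInduction with
  | zero => exact ⟨0, 0, by simp [dChar], by simp [ysym_zero]⟩
  | one => exact ⟨0, 0, by simp [dChar], by simp⟩
  | more n ih _ =>
    obtain ⟨K, c, h1, h2⟩ := ih
    have hs := dStep_mul n
    have hd := congrArg dual hs
    have hinv : ypow 4 * ypow (-4) = 1 := by rw [← ypow_add, add_neg_cancel, ypow_zero]
    have e1 : ysym (2 * ((n + 2 : ℕ) : ℤ)) = ypow (2 * n + 4) + ypow (-(2 * n + 4)) := by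
      rw [ysym]
      push_cast
      ring_nf
    have e2 : ysym (2 * n) = ypow (2 * n + 4) * ypow (-4) + ypow (-(2 * n + 4)) * ypow 4 := by
      rw [ysym]
      simp only [← ypow_add]
      ring_nf
    simp only [map_mul, map_sub, map_one, dual_ypow] at hd
    rw [e2, ysym] at h2
    rw [e1, ysym]
    by_cases hn : Even n
    · rw [if_pos hn] at hs hd h2
      -- For even `n` the term `y⁰` of `dStep n` is self-dual and would be counted twice; one copy
      -- goes to the constant. The value of `c` is immaterial, since only `ψ² - 1` of this sum is
      -- used later.
      refine ⟨K + dStep n + dual (dStep n) - 1, c + 1, ?_, ?_⟩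
      · rw [dChar_add_two, map_add]
        push_cast
        linear_combination h1
      · rw [if_pos (by simpa [Nat.even_add] using hn)]
        rw [neg_zero] at hd
        rw [ypow_zero] at hs hd
        linear_combination h2 - (ypow (-4) - 1) * hs - (ypow 4 - 1) * hd +
          (dStep n + dual (dStep n)) * hinv
    · rw [if_neg hn] at hs hd h2
      refine ⟨K + dStep n + dual (dStep n), c, ?_, ?_⟩
      · rw [dChar_add_two, map_add]
        linear_combination h1
      · rw [if_neg (by simpa [Nat.even_add] using hn)]
        have e3 : ypow 4 * ypow (-2) = ypow 2 := by rw [← ypow_add]; norm_num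
        have e4 : ypow (-4) * ypow 2 = ypow (-2) := by rw [← ypow_add]; norm_num
        rw [ysym] at h2 ⊢
        linear_combination h2 - (ypow (-4) - 1) * hs - (ypow 4 - 1) * hd +
          (dStep n + dual (dStep n)) * hinv + e3 + e4

end FormalChar

end

end AffHecke

namespace AffHecke

noncomputable section

namespace FormalChar

/-! ### The identity of formal characters -/

/-- `PA`, `PB`, `PK` stand for the images of `A`, `B`, `K` under `ψ²`. The hypotheses determine `A +
a`, `B + b`, `PA + a`, `PB + b`, `K` and `PK` as rational functions of `U`, `α`, `β`. What then
remains of `a` and `b` is `(U² - 4)(a² - a + b² - b)`, which vanishes for parities. -/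
theorem const_identity_field {F : Type} [Field F] {U A B PA PB K PK a b α β : F} (hU : U ≠ 0)
    (hT : U ^ 2 - 4 ≠ 0) (hV : U ^ 2 - 2 ≠ 0) (ha : a ^ 2 = a) (hb : b ^ 2 = b)
    (hA : (U ^ 2 - 4) * U * (A + a) = α - U) (hB : (U ^ 2 - 4) * U * (B + b) = β - U)
    (hPA : U ^ 2 * (U ^ 2 - 4) * (U ^ 2 - 2) * (PA + a) = α ^ 2 - U ^ 2)
    (hPB : U ^ 2 * (U ^ 2 - 4) * (U ^ 2 - 2) * (PB + b) = β ^ 2 - U ^ 2)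
    (hK : U ^ 2 * (U ^ 2 - 4) * K = α * β - U ^ 2)
    (hPK : U ^ 2 * (U ^ 2 - 4) * (U ^ 2 - 2) ^ 2 * PK =
      (α ^ 2 - 2) * (β ^ 2 - 2) - (U ^ 2 - 2) ^ 2) :
    -(U ^ 2 - 4) * (A ^ 2 - PA + B ^ 2 - PB + 2 * a * A + 2 * b * B) +
      2 * (-(U ^ 2 * (U ^ 2 - 4)) * (PA * PB + a * PB + b * PA) - a * b * ((U ^ 2 - 2) ^ 2 - 2)
        + PK) -
      2 * (-(U ^ 2 - 4) * (A * B + a * B + b * A) - a * b * (U ^ 2 - 2) + K) = 0 := by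
  have eA : A = (α - U) / ((U ^ 2 - 4) * U) - a := by
    rw [← hA]; field_simp; ring
  have eB : B = (β - U) / ((U ^ 2 - 4) * U) - b := by
    rw [← hB]; field_simp; ring
  have ePA : PA = (α ^ 2 - U ^ 2) / (U ^ 2 * (U ^ 2 - 4) * (U ^ 2 - 2)) - a := by
    rw [← hPA]; field_simp; ring
  have ePB : PB = (β ^ 2 - U ^ 2) / (U ^ 2 * (U ^ 2 - 4) * (U ^ 2 - 2)) - b := by
    rw [← hPB]; field_simp; ring
  have eK : K = (α * β - U ^ 2) / (U ^ 2 * (U ^ 2 - 4)) := by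
    rw [← hK]; field_simp
  have ePK : PK = ((α ^ 2 - 2) * (β ^ 2 - 2) - (U ^ 2 - 2) ^ 2) /
      (U ^ 2 * (U ^ 2 - 4) * (U ^ 2 - 2) ^ 2) := by
    rw [← hPK]; field_simp
  have key : -(U ^ 2 - 4) * (((α - U) / ((U ^ 2 - 4) * U)) ^ 2 -
        (α ^ 2 - U ^ 2) / (U ^ 2 * (U ^ 2 - 4) * (U ^ 2 - 2)) +
        ((β - U) / ((U ^ 2 - 4) * U)) ^ 2 -
        (β ^ 2 - U ^ 2) / (U ^ 2 * (U ^ 2 - 4) * (U ^ 2 - 2))) +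
      2 * (-(U ^ 2 * (U ^ 2 - 4)) * ((α ^ 2 - U ^ 2) / (U ^ 2 * (U ^ 2 - 4) * (U ^ 2 - 2)) *
        ((β ^ 2 - U ^ 2) / (U ^ 2 * (U ^ 2 - 4) * (U ^ 2 - 2)))) +
        ((α ^ 2 - 2) * (β ^ 2 - 2) - (U ^ 2 - 2) ^ 2) /
          (U ^ 2 * (U ^ 2 - 4) * (U ^ 2 - 2) ^ 2)) -
      2 * (-(U ^ 2 - 4) * ((α - U) / ((U ^ 2 - 4) * U) * ((β - U) / ((U ^ 2 - 4) * U))) +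
        (α * β - U ^ 2) / (U ^ 2 * (U ^ 2 - 4))) = 0 := by
    field_simp
    ring
  rw [eA, eB, ePA, ePB, eK, ePK]
  linear_combination key + (U ^ 2 - 4) * ha + (U ^ 2 - 4) * hb

/-- This is the part of the main identity without source coordinates. `Z` collects the terms
multiplied by `η`, including the rank zero normalising factor, and enters `C` as `ψ²Z - Z` by
`lin_adams`. Symmetrisation makes everything a function of `U = y + y⁻¹`, `y^M + y^(-M)` and `y^(M')
+ y^(-M')`. -/
theorem const_identity {M M' a b : ℕ} {A B XA XB : Laurent} (hM : Odd M) (hM' : Odd M')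
    (ha : a < 2) (hb : b < 2) (hA : dual A = A) (hB : dual B = B)
    (hA' : (ysym 1 ^ 2 - 4) * ysym 1 * (A + a) = ysym M - ysym 1)
    (hB' : (ysym 1 ^ 2 - 4) * ysym 1 * (B + b) = ysym M' - ysym 1)
    (hXA : 2 * XA = A ^ 2 - adams A) (hXB : 2 * XB = B ^ 2 - adams B)
    {n n' : ℕ} (hn : 2 * n = M + M') (hn' : (2 * n' : ℤ) = |(M : ℤ) - M'|)
    {C Z : Laurent}
    (hZ : Z = (1 - ypow 2) * (A * B) + B * (1 - ypow (2 * a)) + A * (1 - ypow (2 * b)) -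
      a * b * ypow 2 + (dChar n' + dChar n))
    (hC : C = (1 - ypow 2) * (XA + XB) + A * (1 - ypow (2 * a)) + B * (1 - ypow (2 * b)) +
      (adams Z - Z)) :
    C + dual C = 0 := by
  obtain ⟨K₁, c₁, h1, h1'⟩ := exists_dChar n'
  obtain ⟨K₂, c₂, h2, h2'⟩ := exists_dChar n
  set U := ysym 1 with hU
  have y2 : ysym 2 = U ^ 2 - 2 := ysym_two_mul 1
  have y4 : ysym 4 = (U ^ 2 - 2) ^ 2 - 2 := by rw [← y2]; exact ysym_two_mul 2
  have hx : ypow 2 + ypow (-2) = U ^ 2 - 2 := y2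
  have hpow : ∀ c : ℕ, c < 2 → ypow (2 * c) + ypow (-(2 * c)) = 2 + c * (U ^ 2 - 4) := by
    intro c hc
    rcases (by omega : c = 0 ∨ c = 1) with rfl | rfl
    · simp [ypow_zero]
      norm_num
    · simp only [Nat.cast_one, mul_one, hx]
      ring
  have hK : U ^ 2 * (U ^ 2 - 4) * (K₁ + K₂) = ysym M * ysym M' - U ^ 2 := by
    have e : ysym M * ysym M' = ysym (2 * n) + ysym (2 * n') := by
      rw [ysym_mul, hn', show (2 * (n : ℤ)) = M + M' by exact_mod_cast hn]
      rcases abs_choice ((M : ℤ) - M') with h | h <;> rw [h]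
      rw [ysym_neg]
    rw [y4] at h1' h2'
    rw [y2] at h1' h2'
    -- The sum `n + n'` is the larger of `M` and `M'`, hence odd. So one of the closed forms has the
    -- correction `2` and the other `y² + y⁻² = U² - 2`, which add up to `U²`.
    have hpar : Even n ↔ ¬ Even n' := by
      obtain ⟨k, rfl⟩ := hM
      obtain ⟨k', rfl⟩ := hM'
      rw [Nat.even_iff, Nat.even_iff]
      rcases abs_choice (((2 * k + 1 : ℕ) : ℤ) - (2 * k' + 1 : ℕ)) with h | h <;> rw [h] at hn' <;>
        omega
    by_cases hp : Even n'
    · rw [if_pos hp] at h1'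
      rw [if_neg (by simpa [hpar] using hp)] at h2'
      linear_combination h1' + h2' - e
    · rw [if_neg hp] at h1'
      rw [if_pos (hpar.mpr hp)] at h2'
      linear_combination h1' + h2' - e
  have hUad : adams U = U ^ 2 - 2 := by rw [hU, adams_ysym, mul_one, y2]
  have hyad : ∀ k, adams (ysym k) = ysym k ^ 2 - 2 := fun k => by rw [adams_ysym, ysym_two_mul]
  have hPA := congrArg adams hA'
  have hPB := congrArg adams hB'
  have hPK := congrArg adams hK
  simp only [map_mul, map_add, map_sub, map_pow, hUad, hyad, map_natCast, map_ofNat]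
    at hPA hPB hPK
  have hdX : ∀ {A XA : Laurent}, dual A = A → 2 * XA = A ^ 2 - adams A → dual XA = XA := by
    intro A XA hA hXA
    apply two_mul_cancel
    have := congrArg dual hXA
    rw [map_mul, map_sub, map_pow, dual_adams, hA, map_ofNat] at this
    rw [this, hXA]
  have hdXA := hdX hA hXA
  have hdXB := hdX hB hXB
  have hSZ : Z + dual Z = -(U ^ 2 - 4) * (A * B + a * B + b * A) - a * b * (U ^ 2 - 2) +
      (K₁ + K₂) + (c₁ + c₂) := by
    rw [hZ]
    simp only [map_mul, map_add, map_sub, map_one, dual_ypow, hA, hB, map_natCast]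
    linear_combination h1 + h2 - (A * B + a * b) * hx - B * hpow a ha - A * hpow b hb
  have hSZ' := congrArg adams hSZ
  simp only [map_mul, map_add, map_sub, map_pow, map_neg, hUad, map_natCast, map_intCast,
    map_ofNat] at hSZ'
  have hsq : ∀ c : ℕ, c < 2 → (c : Laurent) ^ 2 = c := by
    intro c hc
    rcases (by omega : c = 0 ∨ c = 1) with rfl | rfl <;> simp
  have hV0 : U ^ 2 - 2 ≠ 0 := by rw [← y2]; exact ysym_ne_zero 2
  have hU0 : U ≠ 0 := ysym_ne_zero 1
  have hT0 : U ^ 2 - 4 ≠ 0 := ysym_one_sq_sub_ne_zero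
  -- The factors `U`, `U² - 4`, `U² - 2` are nonzero but not units, so the identity is checked in
  -- the fraction field and pulled back by injectivity.
  have key := const_identity_field (F := FractionRing Laurent)
    (U := algebraMap _ _ U) (A := algebraMap _ _ A) (B := algebraMap _ _ B)
    (PA := algebraMap _ _ (adams A)) (PB := algebraMap _ _ (adams B))
    (K := algebraMap _ _ (K₁ + K₂)) (PK := algebraMap _ _ (adams K₁ + adams K₂))
    (a := algebraMap _ _ (a : Laurent)) (b := algebraMap _ _ (b : Laurent))
    (α := algebraMap _ _ (ysym M)) (β := algebraMap _ _ (ysym M'))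
  have inj := IsFractionRing.injective Laurent (FractionRing Laurent)
  have h24 : (4 : FractionRing Laurent) = algebraMap Laurent _ 4 := (map_ofNat _ 4).symm
  have h22 : (2 : FractionRing Laurent) = algebraMap Laurent _ 2 := (map_ofNat _ 2).symm
  rw [h24, h22] at key
  simp only [← map_mul, ← map_add, ← map_sub, ← map_pow, ← map_neg] at key
  simp only [← (algebraMap Laurent (FractionRing Laurent)).map_zero, ne_eq, inj.eq_iff] at key
  have e1 : adams (K₁ + K₂) = adams K₁ + adams K₂ := map_add _ _ _
  have e2 : adams (A * B) = adams A * adams B := map_mul _ _ _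
  rw [e1, e2] at key
  specialize key hU0 hT0 hV0 (hsq a ha) (hsq b hb) hA' hB' (by linear_combination hPA)
    (by linear_combination hPB) hK (by linear_combination hPK)
  apply two_mul_cancel
  rw [hC]
  simp only [map_mul, map_add, map_sub, map_one, dual_ypow, hA, hB, hdXA, hdXB, dual_adams]
  linear_combination key - 2 * (XA + XB) * hx + 2 * (hSZ' - hSZ) - (U ^ 2 - 4) * (hXA + hXB) -
    2 * A * hpow a ha - 2 * B * hpow b hb

/-! ### The identity in a group -/

section

variable {Γ G : Type} [CommGroup Γ] [AddCommGroup G]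

/-- The evaluation of Laurent polynomials at a group element. -/
def subst (y : Γ) : Laurent →+* FormalChar Γ := mapHom (zpowersHom Γ y)

@[simp]
theorem subst_ypow (y : Γ) (k : ℤ) : subst y (ypow k) = mon (y ^ k) := by
  simp [subst, ypow]

theorem ch_map_pow (y : Γ) (l : List ℕ) :
    ch (l.map fun k => (y ^ 2) ^ k) = subst y (ch (qList l)) := by
  rw [subst, mapHom_ch, qList, List.map_map]
  congr 1
  refine List.map_congr_left fun k _ => ?_
  change (y ^ 2) ^ k = y ^ (2 * (k : ℤ))
  rw [zpow_mul, zpow_natCast, zpow_ofNat]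

theorem lin_mul_subst {φ : Γ → G} (hinv : ∀ g, φ g⁻¹ = φ g) (y : Γ) {S : FormalChar Γ} {P : Laurent}
    (hS : dual S = S) (hP : P + dual P = 0) : lin φ (S * subst y P) = 0 := by
  apply lin_eq_zero hinv
  rw [map_mul, hS, subst, ← mapHom_dual, ← mul_add, ← map_add, hP, map_zero, mul_zero]

/-- The formal character of the quotient of the factors of a `μ`-function of type `B`; `X` is the
sum of the long roots, `C` that of the short roots, and the exponents of `y` are `2 m₊` for the long
roots, and `2 m₋`, `2 m₊` for the short roots. -/
def muChar (η y : Γ) (X C : FormalChar Γ) (b m m' : ℤ) : FormalChar Γ :=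
  X * (1 - mon (y ^ b)) + C * (1 - mon (y ^ m')) + mon η * (C * (1 - mon (y ^ m)))

/-- The difference of the two sides is written as a sum of elements killed by `φ`: four
antisymmetric ones and two of the form `ψ²P - P - ηP`. The bookkeeping terms `φ(1)`, `φ(y²)`,
`φ(y⁴)`, `φ(η y²)` account for the subtracted ranks in the long root sums and for the normalising
factors. -/
theorem lin_muChar {φ : Γ → G} {η y : Γ} (hη : η ^ 2 = 1) (hinv : ∀ g, φ g⁻¹ = φ g)
    (hsq : ∀ g, φ (g ^ 2) = φ g + φ (η * g)) {M M' a b n n' : ℕ} (hM : Odd M) (hM' : Odd M')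
    (ha : a < 2) (hb : b < 2) (hn : 2 * n = M + M') (hn' : (2 * n' : ℤ) = |(M : ℤ) - M'|)
    {lA lB : List ℕ}
    (hA : (ysym 1 ^ 2 - 4) * ysym 1 * (ch (qList lA) + a) = ysym M - ysym 1)
    (hB : (ysym 1 ^ 2 - 4) * ysym 1 * (ch (qList lB) + b) = ysym M' - ysym 1)
    {ls : List Γ} {l : ℕ} {X X₁ C : FormalChar Γ}
    (hC : C = mon η * subst y (ch (qList lA)) + (mon y + mon y⁻¹) * ch ls +
      subst y (ch (qList lB)))
    (hX : 2 * X = C ^ 2 - adams C - 2 * l)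
    (hX₁ : 2 * X₁ = ch ls ^ 2 - adams (ch ls) - 2 * ls.length) :
    lin φ (muChar η y X C 2 (2 * a) (2 * b)) + l • φ 1 + ls.length • φ (y ^ 4) +
        lin φ (mon η * subst y (dChar n' + dChar n)) =
      lin φ (muChar η y X₁ (ch ls) 4 M M') + ls.length • φ 1 + l • φ (y ^ 2) +
        (a * b) • φ (η * y ^ 2) := by
  set A := ch (qList lA) with hAdef
  set B := ch (qList lB) with hBdef
  set s := ch ls with hs
  obtain ⟨XA, hXA⟩ := exists_half A
  obtain ⟨XB, hXB⟩ := exists_half B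
  have hdA : dual A = A := dual_ch _
  have hdB : dual B = B := dual_ch _
  have hds : dual s = s := dual_ch _
  have hconst := const_identity hM hM' ha hb hdA hdB hA hB hXA hXB hn hn' rfl rfl
  set Z : Laurent := (1 - ypow 2) * (A * B) + B * (1 - ypow (2 * a)) + A * (1 - ypow (2 * b)) -
      a * b * ypow 2 + (dChar n' + dChar n) with hZ
  have hee : mon η * mon η = 1 := by rw [← mon_mul, ← pow_two, hη, mon_one]
  have hyy := mon_mul_inv y
  have hηinv : η⁻¹ = η := inv_eq_of_mul_eq_one_left (by rw [← pow_two, hη])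
  have hde : dual (mon η) = mon η := by rw [dual_mon, hηinv]
  have hj : ∀ P, subst y (adams P) = adams (subst y P) := mapHom_adams _
  have hU : subst y (ysym 1) = mon y + mon y⁻¹ := by simp [ysym]
  have hX₁d : dual X₁ = X₁ := by
    apply two_mul_cancel
    have := congrArg dual hX₁
    simp only [map_mul, map_sub, map_pow, dual_adams, hds, map_natCast, map_ofNat] at this
    rw [this, hX₁]
  have hx2 : mon (y ^ 2) = mon y * mon y := by rw [pow_two, mon_mul]
  -- Expansion of `Λ²` of a sum of three terms. With `w = y + y⁻¹` one has `w² - ψ²w = 2`, so `Λ²(w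
  -- s) = w² Λ²s + ψ²s`; this is the origin of the term `ψ²s`.
  have hXeq : X = subst y XA + subst y XB + mon η * subst y A * subst y B +
      (mon η * subst y A + subst y B) * (mon y + mon y⁻¹) * s +
      (mon y + mon y⁻¹) ^ 2 * (X₁ + ls.length) + adams s - l := by
    apply two_mul_cancel
    have h1 := congrArg (subst y) hXA
    have h2 := congrArg (subst y) hXB
    simp only [map_mul, map_sub, map_pow, map_ofNat, hj] at h1 h2
    have h3 : adams C = adams (subst y A) + (mon y * mon y + mon y⁻¹ * mon y⁻¹) * adams s +
        adams (subst y B) := by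
      rw [hC]
      simp only [map_add, map_mul, adams_mon, hη, mon_one, pow_two, mon_mul, one_mul]
    rw [hX, h3, hC]
    linear_combination (subst y A) ^ 2 * hee - h1 - h2 - (mon y + mon y⁻¹) ^ 2 * hX₁ -
      (-2) * adams s * hyy
  have hlinA : ∀ {c N : ℕ} {P : Laurent}, c < 2 → dual P = P →
      (ysym 1 ^ 2 - 4) * ysym 1 * (P + c) = ysym N - ysym 1 →
      ((ysym 1 * ((1 - ypow 2) * P + 1 - ypow (2 * c)) + (1 - ypow 1) - (1 - ypow N)) +
      dual (ysym 1 * ((1 - ypow 2) * P + 1 - ypow (2 * c)) + (1 - ypow 1) - (1 - ypow N))) = 0 := by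
    intro c N P hc hP h
    have hpow : ypow (2 * c) + ypow (-(2 * c)) = 2 + c * (ysym 1 ^ 2 - 4) := by
      rcases (by omega : c = 0 ∨ c = 1) with rfl | rfl
      · simp [ypow_zero]
        norm_num
      · rw [Nat.cast_one, mul_one, ← ysym, Nat.cast_one, ← mul_one 2, ysym_two_mul]
        ring
    have hx : ypow 2 + ypow (-2) = ysym 1 ^ 2 - 2 := ysym_two_mul 1
    have h1 : ypow 1 + ypow (-1) = ysym 1 := rfl
    have hN : ypow N + ypow (-N) = ysym N := rfl
    simp only [map_add, map_mul, map_sub, map_one, dual_ypow, dual_ysym, hP]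
    linear_combination -h - ysym 1 * P * hx - ysym 1 * hpow - h1 + hN
  -- `P₁`, `P₂`, `P₃`, `P₄` belong to `s`, `ηs`, `Λ²s` and the part free of `s`. The extra `1 - y`
  -- in the first two arises because `(1 - y²) ψ²s = ψ²((1 - y)s)` is traded for `(1 - y)s + η(1 -
  -- y)s`.
  obtain ⟨P₁, hP₁⟩ : ∃ P, P = s * subst y (ysym 1 * ((1 - ypow 2) * B + 1 - ypow (2 * b)) + (1 - ypow 1) -
      (1 - ypow M')) := ⟨_, rfl⟩
  obtain ⟨P₂, hP₂⟩ : ∃ P, P = mon η * s * subst y (ysym 1 * ((1 - ypow 2) * A + 1 - ypow (2 * a)) +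
      (1 - ypow 1) - (1 - ypow M)) := ⟨_, rfl⟩
  obtain ⟨P₃, hP₃⟩ : ∃ P, P = (X₁ + (ls.length : FormalChar Γ)) * subst y ((1 - ypow 2) * ysym 1 ^ 2 -
      (1 - ypow 4)) := ⟨_, rfl⟩
  obtain ⟨P₄, hP₄⟩ : ∃ P, P = 1 * subst y ((1 - ypow 2) * (XA + XB) + A * (1 - ypow (2 * a)) +
      B * (1 - ypow (2 * b)) + (adams Z - Z)) := ⟨_, rfl⟩
  have z1 : lin φ P₁ = 0 := hP₁ ▸ lin_mul_subst hinv y hds (hlinA hb hdB hB)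
  have z2 : lin φ P₂ = 0 :=
    hP₂ ▸ lin_mul_subst hinv y (by rw [map_mul, hde, hds]) (hlinA ha hdA hA)
  have z3 : lin φ P₃ = 0 := by
    rw [hP₃]
    refine lin_mul_subst hinv y (by rw [map_add, hX₁d, map_natCast]) ?_
    have hx : ypow 2 + ypow (-2) = ysym 1 ^ 2 - 2 := ysym_two_mul 1
    have hx4 : ypow 4 + ypow (-4) = (ysym 1 ^ 2 - 2) ^ 2 - 2 := by
      rw [← hx]
      exact ysym_two_mul 2
    simp only [map_mul, map_sub, map_one, map_pow, dual_ypow, dual_ysym]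
    linear_combination hx4 - ysym 1 ^ 2 * hx
  have z4 := lin_adams hsq ((1 - mon y) * s)
  have z5 := lin_adams hsq (subst y Z)
  have z6 : lin φ P₄ = 0 := hP₄ ▸ lin_mul_subst hinv y (S := 1) (map_one _) hconst
  have key : muChar η y X C 2 (2 * a) (2 * b) + (l : FormalChar Γ) * mon 1 +
        (ls.length : FormalChar Γ) * mon (y ^ 4) +
        mon η * subst y (dChar n' + dChar n) -
      (muChar η y X₁ s 4 M M' + (ls.length : FormalChar Γ) * mon 1 + (l : FormalChar Γ) * mon (y ^ 2) +
        ((a * b : ℕ) : FormalChar Γ) * mon (η * y ^ 2)) =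
      P₁ + P₂ + P₃ + (adams ((1 - mon y) * s) - ((1 - mon y) * s + mon η * ((1 - mon y) * s))) -
      (adams (subst y Z) - (subst y Z + mon η * subst y Z)) + P₄ := by
    rw [hP₁, hP₂, hP₃, hP₄]
    have hx2' : mon (y ^ (2 : ℤ)) = mon (y ^ 2) := by rw [← zpow_natCast]; rfl
    have hx4' : mon (y ^ (4 : ℤ)) = mon (y ^ 4) := by rw [← zpow_natCast]; rfl
    have hZ' : subst y Z = (1 - mon (y ^ 2)) * (subst y A * subst y B) +
        subst y B * (1 - mon (y ^ (2 * a : ℤ))) + subst y A * (1 - mon (y ^ (2 * b : ℤ))) -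
        a * b * mon (y ^ 2) + subst y (dChar n' + dChar n) := by
      rw [hZ]
      simp only [map_add, map_mul, map_sub, map_one, subst_ypow, map_natCast, hx2']
    simp only [map_sub, map_mul, map_pow, map_one,
      subst_ypow, adams_mon, muChar, mon_mul, mon_one, hx2', hx4']
    simp only [map_add, map_sub, map_mul, map_one, subst_ypow, hx2', Nat.cast_mul, hj, hU,
      zpow_one] at hZ' ⊢
    rw [hXeq, hC]
    linear_combination subst y A * (1 - mon (y ^ (2 * a : ℤ))) * hee - mon η * hZ'
  have h := congrArg (lin φ) key
  simp only [map_add (lin φ), map_sub (lin φ), z1, z2, z3, z4, z5, z6, ← nsmul_eq_mul, map_nsmul,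
    lin_mon, sub_self, add_zero] at h
  exact sub_eq_zero.mp h

end

end FormalChar

end

end AffHecke

namespace AffHecke

noncomputable section

open FormalChar

/-! ### Sums over the roots of type B -/

section RootSums

variable {Γ Δ G : Type} [CommGroup Γ] [CommGroup Δ] [AddCommGroup G] {n : ℕ}

/-- The value of a root of type `B` at a point with coordinates in a commutative group. -/
def rootProd (t : Fin n → Γ) (a : TypeBIndex n) : Γ := ∏ i, t i ^ typeBRoot n a i

theorem map_rootProd (f : Γ →* Δ) (t : Fin n → Γ) (a : TypeBIndex n) :
    f (rootProd t a) = rootProd (fun i => f (t i)) a := by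
  simp [rootProd]

theorem prod_zpow_single (t : Fin n → Γ) (i : Fin n) (k : ℤ) :
    ∏ j, t j ^ (Pi.single i k : Fin n → ℤ) j = t i ^ k := by
  rw [Finset.prod_eq_single i]
  · simp
  · intro j _ hj
    simp [hj]
  · simp

theorem rootProd_inl (t : Fin n → Γ) (i : Fin n) (e : ℤˣ) :
    rootProd t (.inl (i, e)) = t i ^ (e : ℤ) := prod_zpow_single t i e

theorem rootProd_inr (t : Fin n → Γ) (p : {p : Fin n × Fin n // p.1 < p.2}) (e f : ℤˣ) :
    rootProd t (.inr (p, e, f)) = t p.1.1 ^ (e : ℤ) * t p.1.2 ^ (f : ℤ) := by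
  simp only [rootProd, typeBRoot, Pi.add_apply, zpow_add, Finset.prod_mul_distrib,
    prod_zpow_single]

theorem sum_units {M : Type} [AddCommMonoid M] (f : ℤˣ → M) : ∑ e, f e = f 1 + f (-1) := by
  rw [show (Finset.univ : Finset ℤˣ) = {1, -1} from rfl, Finset.sum_pair (by decide)]

theorem prod_units {M : Type} [CommMonoid M] (f : ℤˣ → M) : ∏ e, f e = f 1 * f (-1) := by
  rw [show (Finset.univ : Finset ℤˣ) = {1, -1} from rfl, Finset.prod_pair (by decide)]

theorem prod_rootProd (t : Fin n → Γ) : ∏ a, rootProd t a = 1 := by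
  rw [Fintype.prod_sum_type, Fintype.prod_prod_type, Fintype.prod_prod_type]
  simp only [Fintype.prod_prod_type, prod_units, rootProd_inl, rootProd_inr]
  have h : ∀ a b : Γ, a * b * (a * b⁻¹) * (a⁻¹ * b * (a⁻¹ * b⁻¹)) = 1 := fun a b => by
    rw [mul_mul_mul_comm a b, mul_mul_mul_comm a⁻¹ b]
    group
  simp [h]

/-- The sum of the short roots. -/
def shortSum (t : Fin n → Γ) : FormalChar Γ := ∑ i, (mon (t i) + mon (t i)⁻¹)

/-- The sum of the long roots. -/
def longSum (t : Fin n → Γ) : FormalChar Γ :=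
  ∑ p : {p : Fin n × Fin n // p.1 < p.2},
    (mon (t p.1.1) + mon (t p.1.1)⁻¹) * (mon (t p.1.2) + mon (t p.1.2)⁻¹)

theorem sq_sum {R : Type} [CommRing R] (w : Fin n → R) :
    (∑ i, w i) ^ 2 =
      ∑ i, w i ^ 2 + 2 * ∑ p : {p : Fin n × Fin n // p.1 < p.2}, w p.1.1 * w p.1.2 := by
  classical
  have h1 : ∑ p : {p : Fin n × Fin n // p.1 < p.2}, w p.1.1 * w p.1.2 =
      ∑ p : Fin n × Fin n, if p.1 < p.2 then w p.1 * w p.2 else 0 := by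
    rw [← Finset.sum_filter, Finset.sum_subtype (p := fun p : Fin n × Fin n => p.1 < p.2)
      (F := inferInstance) _ (by simp) (fun p => w p.1 * w p.2)]
  have h2 : ∑ p : Fin n × Fin n, (if p.1 < p.2 then w p.1 * w p.2 else 0) =
      ∑ p : Fin n × Fin n, if p.2 < p.1 then w p.1 * w p.2 else 0 := by
    rw [← Equiv.sum_comp (Equiv.prodComm (Fin n) (Fin n))]
    simp [mul_comm]
  have h3 : ∑ i, w i ^ 2 = ∑ p : Fin n × Fin n, if p.1 = p.2 then w p.1 * w p.2 else 0 := by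
    rw [Fintype.sum_prod_type]
    simp [pow_two]
  rw [h1, two_mul]
  nth_rewrite 2 [h2]
  rw [h3, ← Finset.sum_add_distrib, ← Finset.sum_add_distrib, pow_two, Finset.sum_mul_sum,
    ← Fintype.sum_prod_type']
  refine Finset.sum_congr rfl fun p _ => ?_
  rcases lt_trichotomy p.1 p.2 with h | h | h
  · simp [h, h.ne, h.not_gt]
  · simp [h]
  · simp [h, h.ne', h.not_gt]

/-- The weights of `Λ²` of the short root character are the long roots together with `n` trivial
weights `tᵢ · tᵢ⁻¹`. -/
theorem two_mul_longSum (t : Fin n → Γ) :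
    2 * longSum t = shortSum t ^ 2 - adams (shortSum t) - 2 * n := by
  have h : ∀ i, (mon (t i) + mon (t i)⁻¹) ^ 2 = adams (mon (t i) + mon (t i)⁻¹) + 2 := by
    intro i
    rw [map_add, adams_mon, adams_mon, pow_two (t i), pow_two (t i)⁻¹, mon_mul, mon_mul]
    linear_combination 2 * mon_mul_inv (t i)
  rw [shortSum, sq_sum, longSum, map_sum]
  simp only [h, Finset.sum_add_distrib, Finset.sum_const, Finset.card_univ, Fintype.card_fin,
    nsmul_eq_mul]
  ring

variable (φ : Γ → G) (η y : Γ)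

/-- The additive analogue of the quotient of the factors of a `μ`-function. -/
def muSum (D : NormalizedHecke (TypeBIndex n) n) (t : Fin n → Γ) : G :=
  ∑ a, (φ (η * rootProd t a) + φ (rootProd t a) -
    (φ (η * (rootProd t a * y ^ D.twoMMinus a)) + φ (rootProd t a * y ^ D.twoMPlus a)))

/-- Long roots have `m₋ = 0`, so their `η`-terms in numerator and denominator cancel; this is why
`muChar` has only one long root term. -/
theorem muSum_eq_lin (b : ℤ) (m m' : ℚ) (d : ℝ → ℝ) (t : Fin n → Γ) :
    muSum φ η y (typeBHecke n b m m' d) t =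
      lin φ (muChar η y (longSum t) (shortSum t) (2 * b)
        (⌊(b : ℚ) * (m' + m)⌋ - ⌊(b : ℚ) * (m' - m)⌋)
        (⌊(b : ℚ) * (m' + m)⌋ + ⌊(b : ℚ) * (m' - m)⌋)) := by
  have hl : ∀ a, (typeBHecke n b m m' d).twoMPlus (.inr a) = 2 * b := fun a => by
    simp [NormalizedHecke.twoMPlus, typeBHecke, typeBNorm, two_mul]
  have hl' : ∀ a, (typeBHecke n b m m' d).twoMMinus (.inr a) = 0 := fun a => by
    simp [NormalizedHecke.twoMMinus, typeBHecke, typeBNorm]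
  have hs : ∀ a, (typeBHecke n b m m' d).twoMPlus (.inl a) =
      ⌊(b : ℚ) * (m' + m)⌋ + ⌊(b : ℚ) * (m' - m)⌋ := fun a => by
    simp [NormalizedHecke.twoMPlus, typeBHecke, typeBNorm]
  have hs' : ∀ a, (typeBHecke n b m m' d).twoMMinus (.inl a) =
      ⌊(b : ℚ) * (m' + m)⌋ - ⌊(b : ℚ) * (m' - m)⌋ := fun a => by
    simp [NormalizedHecke.twoMMinus, typeBHecke, typeBNorm]
  rw [muSum, Fintype.sum_sum_type, muChar, add_assoc, add_comm, map_add]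
  congr 1
  · rw [longSum, Finset.sum_mul, map_sum, Fintype.sum_prod_type]
    refine Finset.sum_congr rfl fun p _ => ?_
    simp only [Fintype.sum_prod_type, sum_units, rootProd_inr, hl, hl', Units.val_one, zpow_one,
      Units.val_neg, zpow_neg, zpow_zero, mul_one]
    simp only [mul_sub, mul_add, add_mul, mul_one, ← mon_mul, map_add, map_sub, lin_mon]
    abel
  · rw [shortSum, Finset.sum_mul, Finset.sum_mul, Finset.mul_sum, ← Finset.sum_add_distrib,
      map_sum, Fintype.sum_prod_type]
    refine Finset.sum_congr rfl fun p _ => ?_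
    simp only [sum_units, rootProd_inl, hs, hs', Units.val_one, zpow_one, Units.val_neg, zpow_neg]
    simp only [mul_sub, mul_add, add_mul, mul_one, ← mon_mul, map_add, map_sub, lin_mon]
    abel

theorem lin_dChar (n : ℕ) : lin φ (mon η * subst y (dChar n)) =
    ∑ i ∈ Finset.Icc 1 (n / 2), i • φ (η * y ^ (2 * ((n : ℤ) - 2 * i))) := by
  rw [dChar, map_sum, Finset.mul_sum, map_sum]
  refine Finset.sum_congr rfl fun i _ => ?_
  rw [map_mul (subst y), map_natCast, subst_ypow, mul_left_comm, ← mon_mul, ← nsmul_eq_mul, map_nsmul,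
    lin_mon]

end RootSums

theorem prod_getD {Γ M : Type} [One Γ] [CommMonoid M] (f : Γ → M) {l : List Γ} {n : ℕ}
    (hn : l.length = n) : ∏ i : Fin n, f (l.getD i 1) = (l.map f).prod := by
  subst hn
  simp [← List.prod_ofFn]

theorem sum_getD {Γ M : Type} [One Γ] [AddCommMonoid M] (f : Γ → M) {l : List Γ} {n : ℕ}
    (hn : l.length = n) : ∑ i : Fin n, f (l.getD i 1) = (l.map f).sum := by
  subst hn
  simp [← List.sum_ofFn]

end

end AffHecke

namespace AffHecke

noncomputable section

/-! ### Monomial maps of tori -/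

section Monomial

theorem charVal_mul {n : ℕ} (χ : Fin n → ℤ) (s t : Torus n) :
    charVal χ (s * t) = charVal χ s * charVal χ t := by
  simp [charVal, mul_zpow, Finset.prod_mul_distrib]

theorem charVal_one {n : ℕ} (χ : Fin n → ℤ) : charVal χ (1 : Torus n) = 1 := by
  simp [charVal]

theorem charVal_single {n : ℕ} (i : Fin n) (k : ℤ) (s : Torus n) :
    charVal (Pi.single i k) s = s i ^ k := prod_zpow_single s i k

/-- The evaluation of characters at a point as a homomorphism. -/
def charHom {n : ℕ} (s : Torus n) : Multiplicative (Fin n → ℤ) →* ℂˣ where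
  toFun χ := charVal χ.toAdd s
  map_one' := charVal_zero s
  map_mul' χ ψ := charVal_add χ.toAdd ψ.toAdd s

variable {r l : ℕ} (c : Torus l) (w : Fin l → Fin r → ℤ)

/-- The map whose coordinates are the monomials `cᵢ s ^ wᵢ`. -/
def monomialMap (s : Torus r) : Torus l := fun i => c i * charVal (w i) s

/-- The pull-back of characters along a monomial map. -/
def pullChar : (Fin l → ℤ) →ₗ[ℤ] (Fin r → ℤ) := Fintype.linearCombination ℤ w

theorem charVal_pullChar (χ : Fin l → ℤ) (s : Torus r) :
    charVal (pullChar w χ) s = ∏ i, charVal (w i) s ^ χ i := by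
  have h := map_prod (charHom s) (fun i => Multiplicative.ofAdd (χ i • w i)) Finset.univ
  rw [← ofAdd_sum] at h
  refine h.trans (Finset.prod_congr rfl fun i _ => ?_)
  rw [ofAdd_zsmul, map_zpow]
  rfl

theorem charVal_monomialMap (χ : Fin l → ℤ) (s : Torus r) :
    charVal χ (monomialMap c w s) = charVal χ c * charVal (pullChar w χ) s := by
  rw [charVal_pullChar]
  simp [charVal, monomialMap, mul_zpow, Finset.prod_mul_distrib]

theorem monomialMap_one : monomialMap c w 1 = c := by
  ext i
  simp [monomialMap, charVal_one]

theorem monomialMap_hom (s s' : Torus r) :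
    monomialMap c w (s * s') / monomialMap c w 1 =
      (monomialMap c w s / monomialMap c w 1) * (monomialMap c w s' / monomialMap c w 1) := by
  rw [monomialMap_one]
  ext i
  simp [monomialMap, charVal_mul]

theorem pullChar_single (i : Fin l) (k : ℤ) : pullChar w (Pi.single i k) = k • w i := by
  simp [pullChar, Fintype.linearCombination_apply_single]

variable {w}

theorem pullChar_section {σ : Fin r → Fin l} (hσ : ∀ j, w (σ j) = Pi.single j 1)
    (ψ : Fin r → ℤ) :
    pullChar w (∑ j, Pi.single (σ j) (ψ j)) = ψ := by
  rw [map_sum]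
  simp only [pullChar_single, hσ]
  ext i
  simp [Finset.sum_apply, Pi.single_apply]

/-- Since every unit vector occurs among the exponents, each character of the source is a nonzero
multiple of a pulled-back one. The map of coordinate rings is thus surjective. -/
theorem isFiniteMorphism_monomialMap {σ : Fin r → Fin l} (hσ : ∀ j, w (σ j) = Pi.single j 1) :
    IsFiniteMorphism (monomialMap c w) := by
  let Φ : CoordRing l →ₐ[ℂ] CoordRing r := AddMonoidAlgebra.lift ℂ (CoordRing r) (Fin l → ℤ)
    { toFun := fun χ =>
        AddMonoidAlgebra.single (pullChar w χ.toAdd) (charVal χ.toAdd c : ℂ)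
      map_one' := by simp [charVal_zero, AddMonoidAlgebra.one_def]
      map_mul' := fun χ ψ => by simp [charVal_add, AddMonoidAlgebra.single_mul_single] }
  have hΦ : ∀ χ, Φ (AddMonoidAlgebra.single χ 1) =
      AddMonoidAlgebra.single (pullChar w χ) (charVal χ c : ℂ) := fun χ => by
    simp [Φ, AddMonoidAlgebra.lift_single]
  have hev : ∀ {n : ℕ} (t : Torus n) (χ : Fin n → ℤ) (z : ℂ),
      evalAt t (AddMonoidAlgebra.single χ z) = z * (charVal χ t : ℂ) := fun t χ z => by
    simp [evalAt, AddMonoidAlgebra.lift_single]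
  refine ⟨Φ, fun f s => ?_, ?_⟩
  · refine DFunLike.congr_fun (f := (evalAt s).comp Φ) (g := evalAt (monomialMap c w s))
      (AddMonoidAlgebra.algHom_ext (fun χ => ?_) (Subsingleton.elim _ _)) f
    rw [AlgHom.comp_apply, hΦ, hev, hev, charVal_monomialMap]
    simp
  · apply RingHom.Finite.of_surjective
    intro f
    induction f using AddMonoidAlgebra.induction_linear with
    | zero => exact ⟨0, map_zero _⟩
    | add f g hf hg =>
      obtain ⟨f', rfl⟩ := hf
      obtain ⟨g', rfl⟩ := hg
      exact ⟨f' + g', map_add _ _ _⟩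
    | single ψ z =>
      set χ : Fin l → ℤ := ∑ j, Pi.single (σ j) (ψ j) with hχ
      refine ⟨(z * (charVal χ c : ℂ)⁻¹) • AddMonoidAlgebra.single χ 1, ?_⟩
      change Φ _ = _
      rw [map_smul, hΦ, hχ, pullChar_section hσ]
      simp

theorem range_monomialMap {σ : Fin r → Fin l} (hσ : ∀ j, w (σ j) = Pi.single j 1) :
    Set.range (monomialMap c w) =
    {t | ∀ χ ∈ LinearMap.ker (pullChar w), charVal χ t = charVal χ c} := by
  ext t
  constructor
  · rintro ⟨s, rfl⟩ χ hχ
    rw [charVal_monomialMap, LinearMap.mem_ker.mp hχ, charVal_zero, mul_one]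
  · intro ht
    refine ⟨fun j => t (σ j) / c (σ j), ?_⟩
    ext i
    congr 1
    -- The preimage is read off from the coordinates `σ j`. This character of the kernel forces the
    -- `i`-th coordinate to agree as well.
    have h := ht (Pi.single i 1 - ∑ j, Pi.single (σ j) (w i j)) (by
      rw [LinearMap.mem_ker, map_sub, pullChar_section hσ, pullChar_single, one_smul, sub_self])
    have key : ∀ u : Torus l, charVal (Pi.single i 1 - ∑ j, Pi.single (σ j) (w i j)) u =
        u i / ∏ j, u (σ j) ^ w i j := fun u => by
      have h1 : charVal (∑ j, Pi.single (σ j) (w i j)) u = ∏ j, u (σ j) ^ w i j := by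
        have h := map_prod (charHom u)
          (fun j => Multiplicative.ofAdd (Pi.single (σ j) (w i j) : Fin l → ℤ)) Finset.univ
        rw [← ofAdd_sum] at h
        refine h.trans (Finset.prod_congr rfl fun j _ => charVal_single _ _ _)
      rw [eq_div_iff_mul_eq', ← h1, ← charVal_add, sub_add_cancel, charVal_single, zpow_one]
    rw [key, key] at h
    simp only [monomialMap, charVal, div_zpow, Finset.prod_div_distrib]
    rw [div_eq_div_iff_mul_eq_mul] at h
    rw [← mul_div_assoc, div_eq_iff_eq_mul, h, mul_comm]

theorem finrank_ker_pullChar {σ : Fin r → Fin l} (hσ : ∀ j, w (σ j) = Pi.single j 1) :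
   
    (Module.finrank ℤ (LinearMap.ker (pullChar w)) : ℤ) = l - r := by
  have h := Submodule.finrank_quotient_add_finrank (LinearMap.ker (pullChar w))
  rw [(LinearMap.quotKerEquivOfSurjective (pullChar w)
    fun ψ => ⟨_, pullChar_section hσ ψ⟩).finrank_eq, Module.finrank_fin_fun,
    Module.finrank_fin_fun] at h
  omega

theorem isResidualCoset_monomialMap {σ : Fin r → Fin l} (hσ : ∀ j, w (σ j) = Pi.single j 1)
    {ι : Type} (D : NormalizedHecke ι l) (v : Param)
    (h : ((D.pPlus v (Set.range (monomialMap c w))).ncard : ℤ) +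
      (D.pMinus v (Set.range (monomialMap c w))).ncard -
      (D.zPlus (Set.range (monomialMap c w))).ncard -
      (D.zMinus (Set.range (monomialMap c w))).ncard = l - r) :
    D.IsResidualCoset v (Set.range (monomialMap c w)) := by
  refine ⟨LinearMap.ker (pullChar w), fun k χ hk hχ => ?_, ⟨c, range_monomialMap c hσ⟩, ?_⟩
  · rw [LinearMap.mem_ker, map_smul] at hχ
    exact (smul_eq_zero.mp hχ).resolve_left hk
  · rw [h, finrank_ker_pullChar hσ]

/-- A coordinate of weight zero gives the constant root `eᵢ`, and two coordinates of equal weight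
give the constant root `eᵢ - eⱼ`. A character orthogonal to their coroots therefore vanishes at
weight zero and depends only on the weight, so it has the form `g ∘ w` with `g 0 = 0`. -/
theorem one_mem_subtorusOf (D : NormalizedHecke (TypeBIndex l) l) (hD : D.datum = typeBDatum l)
    (hc : ∀ g : (Fin r → ℤ) → ℤ, g 0 = 0 → ∏ i, c i ^ g (w i) = 1) :
    monomialMap c w 1 ∈ D.subtorusOf (Set.range (monomialMap c w)) := by
  classical
  intro χ hχ
  rw [monomialMap_one]
  have hconst : ∀ a, pullChar w (typeBRoot l a) = 0 →
      a ∈ D.constRoots (Set.range (monomialMap c w)) := by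
    rintro a ha _ ⟨s, rfl⟩ _ ⟨s', rfl⟩
    have hr : D.datum.root a = typeBRoot l a := by rw [hD]; rfl
    rw [NormalizedHecke.rootVal, NormalizedHecke.rootVal, hr, charVal_monomialMap,
      charVal_monomialMap, ha, charVal_zero, charVal_zero]
  have hco : ∀ a, D.datum.toLinearMap χ (D.datum.coroot a) = χ ⬝ᵥ typeBCoroot l a := fun a => by
    rw [hD]; rfl
  have h0 : ∀ i, w i = 0 → χ i = 0 := by
    intro i hi
    have h := hχ (.inl (i, 1)) (hconst _ (by simp [typeBRoot, pullChar_single, hi]))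
    rw [hco] at h
    simpa [typeBCoroot] using h
  have hlt : ∀ i j, i < j → w i = w j → χ i = χ j := by
    intro i j hij h
    have h := hχ (.inr (⟨(i, j), hij⟩, 1, -1)) (hconst _ (by
      simp only [typeBRoot, map_add, pullChar_single, h]
      simp))
    rw [hco] at h
    simp [typeBCoroot] at h
    omega
  have heq : ∀ i j, w i = w j → χ i = χ j := by
    intro i j h
    rcases lt_trichotomy i j with hij | rfl | hij
    · exact hlt i j hij h
    · rfl
    · exact (hlt j i hij h.symm).symm
  let g : (Fin r → ℤ) → ℤ := fun u => if h : ∃ i, w i = u then χ h.choose else 0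
  have hg : ∀ i, g (w i) = χ i := fun i => by
    have h : ∃ j, w j = w i := ⟨i, rfl⟩
    simp only [g, dif_pos h]
    exact heq _ _ h.choose_spec
  have hg0 : g 0 = 0 := by
    by_cases h : ∃ i, w i = 0
    · simp only [g, dif_pos h]
      exact h0 _ h.choose_spec
    · simp only [g, dif_neg h]
  rw [charVal, ← hc g hg0]
  simp only [hg]

end Monomial

end

end AffHecke

namespace AffHecke

noncomputable section

open FormalChar

/-! ### Formal monomials -/

/-- Formal monomials `± v ^ k s ^ χ` in `v` and the coordinates of a torus of rank `r`. -/
abbrev Mono (r : ℕ) : Type := ℤˣ × Multiplicative ℤ × Multiplicative (Fin r → ℤ)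

namespace Mono

variable {r : ℕ}

/-- The monomial `-1`. -/
def sign : Mono r := (-1, 1, 1)

/-- The monomial `v`. -/
def vgen : Mono r := (1, Multiplicative.ofAdd 1, 1)

/-- The monomial `sⱼ`. -/
def sgen (j : Fin r) : Mono r := (1, 1, Multiplicative.ofAdd (Pi.single j 1))

/-- The exponent of `s`. -/
def wt (g : Mono r) : Fin r → ℤ := g.2.2.toAdd

theorem wt_mul (g h : Mono r) : wt (g * h) = wt g + wt h := rfl

theorem wt_sign : wt (sign : Mono r) = 0 := rfl

theorem wt_vgen : wt (vgen : Mono r) = 0 := rfl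

theorem wt_sgen (j : Fin r) : wt (sgen j) = Pi.single j 1 := rfl

theorem sign_sq : (sign : Mono r) ^ 2 = 1 := rfl

/-- The value of a monomial. -/
def val (v : Param) (s : Torus r) : Mono r →* ℂˣ :=
  (Units.map (Int.castRingHom ℂ : ℤ →* ℂ)).coprod ((zpowersHom ℂˣ v.unit).coprod (charHom s))

theorem val_apply (v : Param) (s : Torus r) (g : Mono r) :
    val v s g = Units.map (Int.castRingHom ℂ : ℤ →* ℂ) g.1 *
      (v.unit ^ g.2.1.toAdd * charVal (wt g) s) := rfl

@[simp]
theorem val_sign (v : Param) (s : Torus r) : val v s sign = -1 := by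
  ext
  simp [val_apply, sign, wt, charVal_zero]

@[simp]
theorem val_vgen (v : Param) (s : Torus r) : val v s vgen = v.unit := by
  simp [val_apply, vgen, wt, charVal_zero]

@[simp]
theorem val_sgen (v : Param) (s : Torus r) (j : Fin r) : val v s (sgen j) = s j := by
  simp [val_apply, sgen, wt, charVal_single]

theorem val_eq_mul (v : Param) (s : Torus r) (g : Mono r) :
    val v s g = val v 1 g * charVal (wt g) s := by
  rw [val_apply, val_apply, charVal_one, mul_one, mul_assoc]

theorem norm_unit_zpow (v : Param) (k : ℤ) : ‖((v.unit ^ k : ℂˣ) : ℂ)‖ = (v : ℝ) ^ k := by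
  have hv : (0 : ℝ) < v := lt_trans one_pos v.2
  simp [Param.unit, abs_of_pos hv]

/-- As `v > 1`, the absolute value determines the exponent of `v`; then only the sign is left. -/
theorem eq_one_of_val_one {v : Param} {g : Mono r} (hw : wt g = 0) {s : Torus r}
    (h : val v s g = 1) : g = 1 := by
  obtain ⟨e, k, χ⟩ := g
  have hχ : χ = 1 := hw
  subst hχ
  rw [val_apply, hw, charVal_zero, mul_one] at h
  have hv : (1 : ℝ) < v := v.2
  have hk : k.toAdd = 0 := by
    have h1 := congrArg (fun z : ℂˣ => ‖(z : ℂ)‖) h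
    simp only [Units.val_mul, norm_mul, norm_unit_zpow, Units.val_one, norm_one] at h1
    have he : ‖((Units.map (Int.castRingHom ℂ : ℤ →* ℂ) e : ℂˣ) : ℂ)‖ = 1 := by
      rcases Int.units_eq_one_or e with rfl | rfl <;> simp
    rw [he, one_mul] at h1
    exact (zpow_eq_one_iff_right₀ (by linarith) hv.ne').mp h1
  have hk' : k = 1 := hk
  subst hk'
  rcases Int.units_eq_one_or e with rfl | rfl
  · rfl
  · have h1 := congrArg (fun z : ℂˣ => (z : ℂ)) h
    norm_num at h1

theorem forall_val_eq_one_iff (v : Param) (g : Mono r) : (∀ s, val v s g = 1) ↔ g = 1 := by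
  refine ⟨fun h => ?_, fun h s => by rw [h, map_one]⟩
  have h1 := h 1
  refine eq_one_of_val_one (funext fun j => ?_) h1
  -- Changing a single coordinate from `1` to `2` isolates its exponent.
  have h2 := h (Function.update 1 j (Units.mk0 2 two_ne_zero))
  rw [val_eq_mul, h1, one_mul, charVal, Finset.prod_eq_single j] at h2
  · have h3 := congrArg (fun z : ℂˣ => ‖(z : ℂ)‖) h2
    simp only [Function.update_self, Units.val_zpow_eq_zpow_val, Units.val_mk0, norm_zpow,
      Complex.norm_ofNat, Units.val_one, norm_one] at h3
    exact (zpow_eq_one_iff_right₀ (by norm_num) (by norm_num)).mp h3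
  · intro i _ hi
    simp [hi]
  · simp

end Mono

open Mono

/-! ### The coordinates of the morphism as formal monomials -/

variable {r : ℕ}

/-- The coordinates of `ξ`, given the exponents of `q` in `rₑ(m₋)` and `rₑ(m₊)`. -/
def monoList (r : ℕ) (lA lB : List ℕ) : List (Mono r) :=
  (lA.map fun k => (vgen ^ 2) ^ k).map (sign * ·) ++
    (List.ofFn sgen).flatMap (fun g => [vgen⁻¹ * g, vgen * g]) ++ lB.map fun k => (vgen ^ 2) ^ k

theorem ch_monoList (lA lB : List ℕ) : ch (monoList r lA lB) =
    mon sign * subst vgen (ch (qList lA)) + (mon vgen + mon vgen⁻¹) * ch (List.ofFn sgen) +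
      subst vgen (ch (qList lB)) := by
  rw [monoList, ch_append, ch_append, ← mon_mul_ch sign_sq, ch_map_pow, ch_map_pow,
    ch_flatMap_pair]

theorem xiList_eq {mMinus mPlus : ℚ} {lA lB : List ℕ}
    (hA : ∀ v, rE v mMinus = lA.map fun k => (v.unit ^ 2) ^ k)
    (hB : ∀ v, rE v mPlus = lB.map fun k => (v.unit ^ 2) ^ k) (v : Param) (s : Torus r) :
    xiList r mMinus mPlus v s = (monoList r lA lB).map (val v s) := by
  have h : List.ofFn s = (List.ofFn sgen).map (val v s) := by
    rw [List.map_ofFn]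
    congr 1
    ext j
    simp
  rw [xiList, monoList, hA, hB, h]
  simp only [List.map_append, List.map_map, List.map_flatMap, List.flatMap_map]
  congr 2
  · congr 1
    funext k
    simp
  · simp
  · funext k
    simp

/-- The `i`-th coordinate of `ξ`. -/
def coordMono (r : ℕ) (lA lB : List ℕ) {l : ℕ} (i : Fin l) : Mono r :=
  (monoList r lA lB).getD i 1

theorem xi_eq {mMinus mPlus : ℚ} {lA lB : List ℕ}
    (hA : ∀ v, rE v mMinus = lA.map fun k => (v.unit ^ 2) ^ k)
    (hB : ∀ v, rE v mPlus = lB.map fun k => (v.unit ^ 2) ^ k) (v : Param) (s : Torus r)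
    (i : Fin (targetRank r mMinus mPlus)) :
    xi r mMinus mPlus v s i = val v s (coordMono r lA lB i) := by
  rw [xi, xiList_eq hA hB, coordMono, ← map_one (val v s), List.getD_map]

theorem xi_eq_monomialMap {mMinus mPlus : ℚ} {lA lB : List ℕ}
    (hA : ∀ v, rE v mMinus = lA.map fun k => (v.unit ^ 2) ^ k)
    (hB : ∀ v, rE v mPlus = lB.map fun k => (v.unit ^ 2) ^ k) (v : Param) :
    xi r mMinus mPlus v = monomialMap (fun i => val v 1 (coordMono r lA lB i))
      (fun i => wt (coordMono r lA lB i)) := by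
  ext s i
  rw [xi_eq hA hB, val_eq_mul]
  rfl

theorem exists_section {lA lB : List ℕ} {l : ℕ} (hl : (monoList r lA lB).length = l) :
    ∃ σ : Fin r → Fin l, ∀ j, wt (coordMono r lA lB (σ j)) = Pi.single j 1 := by
  have h : ∀ j : Fin r, ∃ i : Fin l, wt (coordMono r lA lB i) = Pi.single j 1 := by
    intro j
    have hm : vgen * sgen j ∈ monoList r lA lB := by
      simp only [monoList, List.mem_append, List.mem_flatMap]
      refine Or.inl (Or.inr ⟨sgen j, by simp, by simp⟩)
    obtain ⟨i, hi, h⟩ := List.getElem_of_mem hm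
    refine ⟨⟨i, hl ▸ hi⟩, ?_⟩
    rw [coordMono, List.getD_eq_getElem _ _ hi, h, wt_mul, wt_vgen, wt_sgen, zero_add]
  choose σ hσ using h
  exact ⟨σ, hσ⟩

theorem wt_pow_vgen (k : ℕ) : wt ((vgen ^ 2) ^ k : Mono r) = 0 := by
  change k • (2 • (0 : Fin r → ℤ)) = 0
  simp

/-- Entries from the two residual points have weight zero, hence exponent `g 0 = 0`. The others come
in pairs `v⁻¹sⱼ`, `vsⱼ` of equal weight, whose constants cancel. -/
theorem prod_coord_zpow {lA lB : List ℕ} {l : ℕ} (hl : (monoList r lA lB).length = l) (v : Param)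
    (g : (Fin r → ℤ) → ℤ) (hg : g 0 = 0) :
    ∏ i : Fin l, val v 1 (coordMono r lA lB i) ^ g (wt (coordMono r lA lB i)) = 1 := by
  refine (prod_getD (fun γ : Mono r => val v 1 γ ^ g (wt γ)) hl).trans ?_
  have h1 : ∀ l : List ℕ, ((l.map fun k => ((vgen : Mono r) ^ 2) ^ k).map
      fun γ => val v 1 γ ^ g (wt γ)).prod = 1 := fun l => by
    refine List.prod_eq_one fun x hx => ?_
    simp only [List.mem_map] at hx
    obtain ⟨_, ⟨k, _, rfl⟩, rfl⟩ := hx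
    rw [wt_pow_vgen, hg, zpow_zero]
  have h2 : ∀ l : List ℕ, (((l.map fun k => ((vgen : Mono r) ^ 2) ^ k).map (sign * ·)).map
      fun γ => val v 1 γ ^ g (wt γ)).prod = 1 := fun l => by
    refine List.prod_eq_one fun x hx => ?_
    simp only [List.mem_map] at hx
    obtain ⟨_, ⟨_, ⟨k, _, rfl⟩, rfl⟩, rfl⟩ := hx
    rw [wt_mul, wt_sign, wt_pow_vgen, add_zero, hg, zpow_zero]
  have h3 : ∀ ls : List (Mono r), (∀ γ ∈ ls, val v 1 γ = 1) →
      ((ls.flatMap fun γ => [vgen⁻¹ * γ, vgen * γ]).map fun γ => val v 1 γ ^ g (wt γ)).prod = 1 := by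
    intro ls hls
    induction ls with
    | nil => simp
    | cons γ ls ih =>
      have hv : wt (vgen⁻¹ * γ) = wt γ := by
        change -0 + wt γ = wt γ
        simp
      have hv' : wt (vgen * γ) = wt γ := by rw [wt_mul, wt_vgen, zero_add]
      simp only [List.mem_cons, forall_eq_or_imp] at hls
      simp only [List.flatMap_cons, List.map_append, List.prod_append, ih hls.2, mul_one,
        List.map_cons, List.map_nil, List.prod_cons, List.prod_nil, hv, hv', map_mul, hls.1,
        map_inv, inv_zpow, inv_mul_cancel]
  rw [monoList, List.map_append, List.map_append, List.prod_append, List.prod_append, h1, h2, h3]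
  · simp
  · intro γ hγ
    obtain ⟨j, rfl⟩ := (List.mem_ofFn (f := sgen)).mp hγ
    simp

/-! ### The image is a residual coset -/

theorem rootVal_eq_val {l : ℕ} (D : NormalizedHecke (TypeBIndex l) l)
    (hD : D.datum = typeBDatum l) {t : Fin l → Mono r} {v : Param} {φ : Torus r → Torus l}
    (hφ : ∀ s i, φ s i = val v s (t i)) (s : Torus r) (a : TypeBIndex l) :
    D.rootVal a (φ s) = val v s (rootProd t a) := by
  have hr : D.datum.root a = typeBRoot l a := by rw [hD]; rfl
  rw [map_rootProd, NormalizedHecke.rootVal, hr, rootProd, charVal]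
  simp only [hφ]

section Sets

variable {l : ℕ} {D : NormalizedHecke (TypeBIndex l) l} 
  {t : Fin l → Mono r} {v : Param} {φ : Torus r → Torus l} (a : TypeBIndex l)

theorem mem_zPlus_iff (hD : D.datum = typeBDatum l) (hφ : ∀ s i, φ s i = val v s (t i)) :
    a ∈ D.zPlus (Set.range φ) ↔ rootProd t a = 1 := by
  rw [← forall_val_eq_one_iff v]
  simp [NormalizedHecke.zPlus, rootVal_eq_val D hD hφ]

theorem mem_zMinus_iff (hD : D.datum = typeBDatum l) (hφ : ∀ s i, φ s i = val v s (t i)) :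
    a ∈ D.zMinus (Set.range φ) ↔ sign * rootProd t a = 1 := by
  rw [← forall_val_eq_one_iff v]
  simp [NormalizedHecke.zMinus, rootVal_eq_val D hD hφ]

theorem mem_pPlus_iff (hD : D.datum = typeBDatum l) (hφ : ∀ s i, φ s i = val v s (t i)) :
    a ∈ D.pPlus v (Set.range φ) ↔ rootProd t a * vgen ^ D.twoMPlus a = 1 := by
  rw [← forall_val_eq_one_iff v]
  simp [NormalizedHecke.pPlus, rootVal_eq_val D hD hφ, mul_eq_one_iff_eq_inv]

theorem mem_pMinus_iff (hD : D.datum = typeBDatum l) (hφ : ∀ s i, φ s i = val v s (t i)) :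
    a ∈ D.pMinus v (Set.range φ) ↔ sign * (rootProd t a * vgen ^ D.twoMMinus a) = 1 := by
  rw [← forall_val_eq_one_iff v, ← mul_assoc]
  simp [NormalizedHecke.pMinus, rootVal_eq_val D hD hφ, -neg_mul, neg_one_mul,
    mul_eq_one_iff_eq_inv]

/-- The counting function of the trivial monomial. -/
def isOne (g : Mono r) : ℤ := if g = 1 then 1 else 0

theorem ncard_eq_sum_isOne {ι : Type} [Fintype ι] {S : Set ι} {f : ι → Mono r}
    (h : ∀ a, a ∈ S ↔ f a = 1) : (S.ncard : ℤ) = ∑ a, isOne (f a) := by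
  classical
  rw [show S = {a | f a = 1} from Set.ext h, Set.ncard_eq_toFinset_card']
  simp [isOne]

/-- A root lies in one of the four sets exactly when the monomial of the corresponding factor is
formally trivial, because a monomial identically `1` on the torus is trivial. -/
theorem ncard_eq_muSum (hD : D.datum = typeBDatum l) (hφ : ∀ s i, φ s i = val v s (t i)) :
    ((D.pPlus v (Set.range φ)).ncard : ℤ) + (D.pMinus v (Set.range φ)).ncard -
      (D.zPlus (Set.range φ)).ncard - (D.zMinus (Set.range φ)).ncard =
    -muSum isOne sign vgen D t := by
  rw [ncard_eq_sum_isOne fun a => mem_zPlus_iff a hD hφ,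
    ncard_eq_sum_isOne fun a => mem_zMinus_iff a hD hφ,
    ncard_eq_sum_isOne fun a => mem_pPlus_iff a hD hφ,
    ncard_eq_sum_isOne fun a => mem_pMinus_iff a hD hφ, muSum]
  simp only [Finset.sum_sub_distrib, Finset.sum_add_distrib]
  ring

theorem isOne_inv (g : Mono r) : isOne g⁻¹ = isOne g := by simp [isOne]

/-- The only torsion in the group of monomials is `±1`. -/
theorem isOne_sq (g : Mono r) : isOne (g ^ 2) = isOne g + isOne (sign * g) := by
  have h : g ^ 2 = 1 ↔ g = 1 ∨ sign * g = 1 := by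
    obtain ⟨e, k, χ⟩ := g
    rcases Int.units_eq_one_or e with rfl | rfl <;> simp [sign, Prod.ext_iff]
  have hne : ¬ (g = 1 ∧ sign * g = 1) := by
    rintro ⟨rfl, h1⟩
    simp [sign, Prod.ext_iff] at h1
  simp only [isOne, h]
  by_cases h1 : g = 1 <;> by_cases h2 : sign * g = 1 <;> simp_all

end Sets

end

end AffHecke

/-! ### The transfer identity for type `B` and the codimension count -/

namespace AffHecke

noncomputable section

open FormalChar Mono

theorem floor_add_floor {a b : ℚ} {x y : ℤ} (h1 : (x : ℚ) = a) (h2 : (y : ℚ) = b) :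
    ⌊a⌋ - ⌊b⌋ = x - y ∧ ⌊a⌋ + ⌊b⌋ = x + y := by
  rw [← h1, ← h2, Int.floor_intCast, Int.floor_intCast]
  exact ⟨rfl, rfl⟩

theorem shortSum_sgen (r : ℕ) : shortSum (sgen : Fin r → Mono r) = ch (List.ofFn sgen) := by
  rw [ch, List.map_ofFn, List.sum_ofFn]
  rfl

theorem shortSum_coordMono {r : ℕ} {lA lB : List ℕ} {l : ℕ}
    (hl : (monoList r lA lB).length = l) :
    shortSum (fun i : Fin l => coordMono r lA lB i) = ch (monoList r lA lB) :=
  sum_getD (fun g => mon g + mon g⁻¹) hl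

/-- The identity behind the transfer morphism, for functions on monomials with the symmetries of the
factors of a `μ`-function. -/
theorem muSum_target {r : ℕ} {G : Type} [AddCommGroup G] {φ : Mono r → G}
    (hinv : ∀ g, φ g⁻¹ = φ g) (hsq : ∀ g, φ (g ^ 2) = φ g + φ (sign * g))
    {m m' : ℚ} {M M' n n' : ℕ} (hm : (M : ℚ) = 4 * m) (hm' : (M' : ℚ) = 4 * m')
    (hM : Odd M) (hM' : Odd M') (hn : 2 * n = M + M') (hn' : (2 * n' : ℤ) = |(M : ℤ) - M'|)
    {lA lB : List ℕ} (hA : IsExponentList m M lA) (hB : IsExponentList m' M' lB) {l : ℕ}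
    (hl : (monoList r lA lB).length = l) :
    muSum φ sign vgen (targetHecke l (delta m) (delta m')) (fun i => coordMono r lA lB i) +
        l • φ 1 + r • φ (vgen ^ 4) +
        (∑ i ∈ Finset.Icc 1 (n' / 2), i • φ (sign * vgen ^ (2 * ((n' : ℤ) - 2 * i))) +
          ∑ i ∈ Finset.Icc 1 (n / 2), i • φ (sign * vgen ^ (2 * ((n : ℤ) - 2 * i)))) =
      muSum φ sign vgen (sourceHecke r m m') sgen + r • φ 1 + l • φ (vgen ^ 2) +
        (delta m * delta m') • φ (sign * vgen ^ 2) := by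
  obtain ⟨k, hk⟩ : ∃ k : ℤ, 2 * k = (M' : ℤ) - M := by
    obtain ⟨a, rfl⟩ := hM
    obtain ⟨b, rfl⟩ := hM'
    exact ⟨b - a, by push_cast; ring⟩
  have hnq : (2 * n : ℚ) = M + M' := by exact_mod_cast hn
  have hkq : (2 * k : ℚ) = M' - M := by exact_mod_cast hk
  -- For the source, `n` and `k` are the values of `m_R` over the short roots at even and odd
  -- height, so `2m₋(α) = n - k = M` and `2m₊(α) = n + k = M'`.
  obtain ⟨f1, f2⟩ := floor_add_floor (a := ((2 : ℤ) : ℚ) * (m' + m)) (b := ((2 : ℤ) : ℚ) * (m' - m))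
    (x := n) (y := k) (by push_cast; linarith) (by push_cast; linarith)
  obtain ⟨f3, f4⟩ := floor_add_floor (a := ((1 : ℤ) : ℚ) * ((delta m' : ℕ) + (delta m : ℕ)))
    (b := ((1 : ℤ) : ℚ) * ((delta m' : ℕ) - (delta m : ℕ)))
    (x := delta m' + delta m) (y := delta m' - delta m) (by push_cast; ring) (by push_cast; ring)
  have h := lin_muChar sign_sq hinv hsq (y := vgen) hM hM' (Nat.mod_lt _ two_pos)
    (Nat.mod_lt _ two_pos) hn hn' hA.2 hB.2 (ch_monoList lA lB)
    (l := l) (X := longSum (fun i : Fin l => coordMono r lA lB i))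
    (X₁ := longSum (sgen : Fin r → Mono r))
    (by rw [two_mul_longSum, shortSum_coordMono hl])
    (by rw [two_mul_longSum, shortSum_sgen, List.length_ofFn])
  rw [List.length_ofFn, map_add (subst vgen), mul_add, map_add (lin φ), lin_dChar, lin_dChar] at h
  rw [targetHecke, sourceHecke, muSum_eq_lin, muSum_eq_lin, f1, f2, f3, f4, shortSum_sgen,
    shortSum_coordMono hl]
  rw [show (n : ℤ) - k = M by omega, show (n : ℤ) + k = M' by omega,
    show ((delta m' : ℤ) + delta m - (delta m' - delta m)) = 2 * delta m by ring,
    show ((delta m' : ℤ) + delta m + (delta m' - delta m)) = 2 * delta m' by ring]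
  exact h

theorem isOne_eq_zero {r : ℕ} {g : Mono r} (h : g ≠ 1) : isOne g = 0 := if_neg h

theorem sign_mul_vgen_zpow_ne_one {r : ℕ} (k : ℤ) : (sign : Mono r) * vgen ^ k ≠ 1 := by
  intro h
  have := congrArg Prod.fst h
  simp [sign, vgen] at this

theorem vgen_pow_ne_one {r : ℕ} {k : ℕ} (hk : k ≠ 0) : (vgen : Mono r) ^ k ≠ 1 := by
  intro h
  have h1 : k • (1 : ℤ) = 0 := congrArg (fun g : Mono r => g.2.1.toAdd) h
  simp at h1
  exact hk h1

theorem wt_rootProd_sgen {r : ℕ} (a : TypeBIndex r) :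
    wt (rootProd (sgen : Fin r → Mono r) a) = typeBRoot r a := by
  let W : Mono r →* Multiplicative (Fin r → ℤ) :=
    (MonoidHom.snd _ _).comp (MonoidHom.snd _ _)
  have h1 : ∀ g : Mono r, wt g = (W g).toAdd := fun _ => rfl
  have h2 : ∀ j, W (sgen j) = Multiplicative.ofAdd (Pi.single j 1) := fun _ => rfl
  rw [h1, map_rootProd]
  rcases a with ⟨i, e⟩ | ⟨p, e, f⟩
  · rw [rootProd_inl, h2, toAdd_zpow]
    simp [typeBRoot, ← Pi.single_smul]
  · rw [rootProd_inr, h2, h2, toAdd_mul, toAdd_zpow, toAdd_zpow]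
    simp [typeBRoot, ← Pi.single_smul]

theorem typeBRoot_ne_zero {r : ℕ} (a : TypeBIndex r) : typeBRoot r a ≠ 0 := by
  intro h
  have h1 := typeBRoot_dot r a
  rw [h, zero_dotProduct] at h1
  rcases typeBNorm_eq r a with h2 | h2 <;> omega

theorem ne_one_of_wt {r : ℕ} {g : Mono r} (h : wt g ≠ 0) : g ≠ 1 := by
  rintro rfl
  exact h rfl

theorem wt_vgen_zpow {r : ℕ} (k : ℤ) : wt (vgen ^ k : Mono r) = 0 := by
  change k • (0 : Fin r → ℤ) = 0
  simp

theorem rootProd_sgen_ne_one {r : ℕ} (a : TypeBIndex r) (k : ℤ) :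
    rootProd (sgen : Fin r → Mono r) a * vgen ^ k ≠ 1 ∧
      sign * (rootProd (sgen : Fin r → Mono r) a * vgen ^ k) ≠ 1 := by
  constructor <;> apply ne_one_of_wt <;>
    simp only [wt_mul, wt_sign, wt_vgen_zpow, wt_rootProd_sgen, zero_add, add_zero] <;>
    exact typeBRoot_ne_zero a

/-- On the source torus each factor involves a nonzero root as exponent of `s`, so none is trivial
and nothing has to be regularised. -/
theorem muSum_isOne_source {r : ℕ} (D : NormalizedHecke (TypeBIndex r) r) :
    muSum isOne sign vgen D (sgen : Fin r → Mono r) = 0 := by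
  refine Finset.sum_eq_zero fun a _ => ?_
  have h0 := rootProd_sgen_ne_one a 0
  rw [zpow_zero, mul_one] at h0
  rw [isOne_eq_zero h0.1, isOne_eq_zero h0.2, isOne_eq_zero (rootProd_sgen_ne_one a _).1,
    isOne_eq_zero (rootProd_sgen_ne_one a _).2]
  rfl

theorem exists_dNat {M M' : ℕ} (hM : Odd M) (hM' : Odd M') :
    ∃ n n' : ℕ, 2 * n = M + M' ∧ (2 * n' : ℤ) = |(M : ℤ) - M'| := by
  obtain ⟨a, rfl⟩ := hM
  obtain ⟨b, rfl⟩ := hM'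
  refine ⟨a + b + 1, ((a : ℤ) - b).natAbs, by ring, ?_⟩
  rw [Int.natCast_natAbs]
  push_cast
  rw [← abs_two, ← abs_mul, abs_two]
  congr 1
  ring

/-- In the transfer identity for the counting function only the terms `l φ(1)` and `r φ(1)` survive
besides the target sum. -/
theorem isOne_target {r : ℕ} {m m' : ℚ} {M M' : ℕ} (hm : (M : ℚ) = 4 * m) (hm' : (M' : ℚ) = 4 * m')
    (hM : Odd M) (hM' : Odd M') {lA lB : List ℕ} (hA : IsExponentList m M lA)
    (hB : IsExponentList m' M' lB) {l : ℕ} (hl : (monoList r lA lB).length = l) :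
    -muSum isOne sign vgen (targetHecke l (delta m) (delta m'))
      (fun i => coordMono r lA lB i) = l - r := by
  obtain ⟨n, n', hn, hn'⟩ := exists_dNat hM hM'
  have h := muSum_target isOne_inv isOne_sq hm hm' hM hM' hn hn' hA hB hl
  have h1 : isOne (1 : Mono r) = 1 := if_pos rfl
  have h2 : isOne (sign * vgen ^ 2 : Mono r) = 0 := isOne_eq_zero (sign_mul_vgen_zpow_ne_one 2)
  rw [muSum_isOne_source, h1, h2, isOne_eq_zero (vgen_pow_ne_one two_ne_zero),
    isOne_eq_zero (vgen_pow_ne_one four_ne_zero)] at h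
  simp only [isOne_eq_zero (sign_mul_vgen_zpow_ne_one _), smul_zero, Finset.sum_const_zero,
    add_zero, nsmul_eq_mul, mul_one, zero_add] at h
  linarith

end

end AffHecke

namespace AffHecke

noncomputable section

open FormalChar Mono

namespace Mono

variable {r : ℕ}

/-! ### Regularised factors of the `μ`-function -/

open scoped Classical in
/-- The factor `1 - g⁻¹`, replaced by `1` if `g` is trivial. -/
def regFactor (v : Param) (s : Torus r) (g : Mono r) : ℂ :=
  if g = 1 then 1 else 1 - ((val v s g : ℂˣ) : ℂ)⁻¹

section Reg

variable {l : ℕ} {D : NormalizedHecke (TypeBIndex l) l} {t : Fin l → Mono r} {v : Param}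
  {φ : Torus r → Torus l}

theorem prod_filter_regFactor {ι : Type} [Fintype ι] {S : Set ι} {_ : DecidablePred fun i => i ∉ S}
    {g : ι → Mono r} (h : ∀ a, a ∈ S ↔ g a = 1) {s : Torus r} {F : ι → ℂ}
    (hF : ∀ a, F a = 1 - ((val v s (g a) : ℂˣ) : ℂ)⁻¹) :
    ∏ a with a ∉ S, F a = ∏ a, regFactor v s (g a) := by
  rw [Finset.prod_filter]
  refine Finset.prod_congr rfl fun a _ => ?_
  simp only [h, regFactor, hF, ite_not]

theorem muRegNum_eq (hD : D.datum = typeBDatum l) (hφ : ∀ s i, φ s i = val v s (t i))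
    (s : Torus r) : D.muRegNum v (Set.range φ) (φ s) =
      (D.d v : ℂ) * (v.unit : ℂ) ^ (-D.twoMW) *
        ∏ a, (regFactor v s (sign * rootProd t a) * regFactor v s (rootProd t a)) := by
  rw [NormalizedHecke.muRegNum, Finset.prod_mul_distrib, mul_assoc ((D.d v : ℂ) * _),
    prod_filter_regFactor (v := v) (s := s) (fun a => mem_zMinus_iff a hD hφ),
    prod_filter_regFactor (v := v) (s := s) (fun a => mem_zPlus_iff a hD hφ)]
  · intro a
    rw [rootVal_eq_val D hD hφ]
  · intro a
    rw [rootVal_eq_val D hD hφ]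
    simp

theorem muRegDen_eq (hD : D.datum = typeBDatum l) (hφ : ∀ s i, φ s i = val v s (t i))
    (s : Torus r) : D.muRegDen v (Set.range φ) (φ s) =
      ∏ a, (regFactor v s (sign * (rootProd t a * vgen ^ D.twoMMinus a)) *
        regFactor v s (rootProd t a * vgen ^ D.twoMPlus a)) := by
  rw [NormalizedHecke.muRegDen, Finset.prod_mul_distrib,
    prod_filter_regFactor (v := v) (s := s) (fun a => mem_pMinus_iff a hD hφ),
    prod_filter_regFactor (v := v) (s := s) (fun a => mem_pPlus_iff a hD hφ)]
  · intro a
    rw [rootVal_eq_val D hD hφ]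
    simp [mul_comm]
  · intro a
    rw [rootVal_eq_val D hD hφ]
    simp [mul_comm]

end Reg

section Source

variable {D : NormalizedHecke (TypeBIndex r) r} (v : Param) (s : Torus r)

theorem rootVal_sgen (hD : D.datum = typeBDatum r) (a : TypeBIndex r) :
    D.rootVal a s = val v s (rootProd sgen a) :=
  rootVal_eq_val (φ := id) D hD (fun s i => (val_sgen v s i).symm) s a

theorem muNum_eq (hD : D.datum = typeBDatum r) : D.muNum v s =
      (D.d v : ℂ) * (v.unit : ℂ) ^ (-D.twoMW) *
        ∏ a, (regFactor v s (sign * rootProd sgen a) * regFactor v s (rootProd sgen a)) := by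
  rw [NormalizedHecke.muNum]
  congr 1
  refine Finset.prod_congr rfl fun a _ => ?_
  have h := rootProd_sgen_ne_one a 0
  rw [zpow_zero, mul_one] at h
  rw [regFactor, regFactor, if_neg h.1, if_neg h.2, rootVal_sgen v s hD a]
  simp
  ring

theorem muDen_eq (hD : D.datum = typeBDatum r) : D.muDen v s =
      ∏ a, (regFactor v s (sign * (rootProd sgen a * vgen ^ D.twoMMinus a)) *
        regFactor v s (rootProd sgen a * vgen ^ D.twoMPlus a)) := by
  rw [NormalizedHecke.muDen]
  refine Finset.prod_congr rfl fun a _ => ?_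
  rw [regFactor, regFactor, if_neg (rootProd_sgen_ne_one a _).1,
    if_neg (rootProd_sgen_ne_one a _).2, rootVal_sgen v s hD a]
  simp
  ring

end Source

/-! ### Symmetric factors at generic points -/

/-- The generic points: a parameter and square roots of the coordinates of a point at which no
nontrivial monomial takes the value `1`. -/
abbrev GenericPoint (r : ℕ) : Type :=
  {p : Param × Torus r // ∀ g : Mono r, g ≠ 1 → val p.1 (p.2 ^ 2) g ≠ 1}

theorem exists_sq (z : ℂˣ) : ∃ w : ℂˣ, w ^ 2 = z := by
  obtain ⟨w, hw⟩ := IsAlgClosed.exists_pow_nat_eq (z : ℂ) two_pos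
  have h0 : w ≠ 0 := by
    rintro rfl
    rw [zero_pow two_ne_zero] at hw
    exact z.ne_zero hw.symm
  exact ⟨Units.mk0 w h0, Units.ext hw⟩

/-- A square root of `v`. -/
def sqrtUnit (v : Param) : ℂˣ := (exists_sq v.unit).choose

theorem sqrtUnit_sq (v : Param) : sqrtUnit v ^ 2 = v.unit := (exists_sq v.unit).choose_spec

/-- The square root of the absolute part of a monomial. -/
def half (p : Param × Torus r) : Mono r →* ℂˣ :=
  ((zpowersHom ℂˣ (sqrtUnit p.1)).coprod (charHom p.2)).comp (MonoidHom.snd _ _)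

/-- The sign of a monomial. -/
def sgn (g : Mono r) : ℂ := ((g.1 : ℤ) : ℂ)

theorem sgn_mul_sgn (g : Mono r) : sgn g * sgn g = 1 := by
  rcases Int.units_eq_one_or g.1 with h | h <;> simp [sgn, h]

theorem val_eq_half (p : Param × Torus r) (g : Mono r) :
    ((val p.1 (p.2 ^ 2) g : ℂˣ) : ℂ) = sgn g * ((half p g : ℂˣ) : ℂ) ^ 2 := by
  have h : val p.1 (p.2 ^ 2) g =
      Units.map (Int.castRingHom ℂ : ℤ →* ℂ) g.1 * half p g ^ 2 := by
    rw [val_apply, ← sqrtUnit_sq, pow_two p.2, charVal_mul, ← zpow_natCast (sqrtUnit p.1),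
      zpow_comm, zpow_natCast, ← pow_two, ← mul_pow]
    rfl
  rw [h]
  simp [sgn]

theorem half_sign (p : Param × Torus r) : half p sign = 1 := by
  simp [half, sign]

theorem half_vgen (p : Param × Torus r) : half p vgen = sqrtUnit p.1 := by
  simp [half, vgen]

open scoped Classical in
/-- The symmetric form `g^{1/2} - g^{-1/2}` of the factor of a monomial. -/
def symFactor (p : Param × Torus r) (g : Mono r) : ℂ :=
  if g = 1 then 1 else ((half p g : ℂˣ) : ℂ) - sgn g * ((half p g : ℂˣ) : ℂ)⁻¹

theorem symFactor_one (p : Param × Torus r) : symFactor p 1 = 1 := if_pos rfl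

theorem symFactor_of_ne {p : Param × Torus r} {g : Mono r} (h : g ≠ 1) :
    symFactor p g = ((half p g : ℂˣ) : ℂ) - sgn g * ((half p g : ℂˣ) : ℂ)⁻¹ := if_neg h

/-- With `g = ε h²`, `ε = ±1`, one has `1 - g⁻¹ = h⁻¹ (h - ε h⁻¹)`. The second factor has the
inversion symmetry; the powers `h⁻¹` are collected over all roots later. -/
theorem regFactor_eq (p : Param × Torus r) (g : Mono r) :
    regFactor p.1 (p.2 ^ 2) g = ((half p g : ℂˣ) : ℂ)⁻¹ * symFactor p g := by
  by_cases h : g = 1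
  · simp [regFactor, symFactor, h]
  · have h0 := (half p g).ne_zero
    have h1 := sgn_mul_sgn g
    have h2 : sgn g ≠ 0 := left_ne_zero_of_mul_eq_one h1
    rw [regFactor, if_neg h, symFactor_of_ne h, val_eq_half]
    field_simp
    linear_combination h1

theorem symFactor_ne_zero (ω : GenericPoint r) (g : Mono r) : symFactor ω.1 g ≠ 0 := by
  by_cases h : g = 1
  · simp [symFactor, h]
  · intro h1
    have h2 := regFactor_eq ω.1 g
    rw [h1, mul_zero, regFactor, if_neg h, sub_eq_zero, eq_comm, inv_eq_one] at h2
    exact ω.2 g h (Units.ext h2)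

/-- The symmetric factor as a unit-valued function on generic points. -/
def symUnit (g : Mono r) (ω : GenericPoint r) : ℂˣ :=
  Units.mk0 (symFactor ω.1 g) (symFactor_ne_zero ω g)

/-- The constant functions with values in `ℚˣ`. -/
def ratConst (r : ℕ) : ℚˣ →* (GenericPoint r → ℂˣ) :=
  MonoidHom.pi fun _ => Units.map (algebraMap ℚ ℂ : ℚ →* ℂ)

/-- Unit-valued functions on generic points up to rational constants. -/
abbrev FunModRat (r : ℕ) : Type := (GenericPoint r → ℂˣ) ⧸ (ratConst r).range

/-- The class of a symmetric factor up to rational constants. -/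
def symClass (g : Mono r) : Additive (FunModRat r) :=
  Additive.ofMul (QuotientGroup.mk (symUnit g))

theorem mk_eq_mk_iff {F F' : GenericPoint r → ℂˣ} :
    (QuotientGroup.mk F : FunModRat r) = QuotientGroup.mk F' ↔
      ∃ q : ℚ, q ≠ 0 ∧ ∀ ω, (F' ω : ℂ) = q * (F ω : ℂ) := by
  rw [QuotientGroup.eq]
  constructor
  · rintro ⟨q, hq⟩
    refine ⟨q, q.ne_zero, fun ω => ?_⟩
    have h := congrFun hq ω
    have h1 : F' ω = Units.map (algebraMap ℚ ℂ : ℚ →* ℂ) q * F ω := by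
      rw [show Units.map (algebraMap ℚ ℂ : ℚ →* ℂ) q = (F⁻¹ * F') ω from h]
      simp
    rw [h1]
    simp
  · rintro ⟨q, hq, h⟩
    refine ⟨Units.mk0 q hq, ?_⟩
    ext ω
    simp only [Pi.mul_apply, Pi.inv_apply, Units.val_mul, h]
    rw [mul_left_comm, Units.inv_mul, mul_one]
    rfl

/-- Inversion multiplies the symmetric factor by `-ε`, where `ε` is the sign of `g`. -/
theorem symClass_inv (g : Mono r) : symClass g⁻¹ = symClass g := by
  refine congrArg Additive.ofMul (mk_eq_mk_iff.mpr ?_)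
  by_cases h : g = 1
  · exact ⟨1, one_ne_zero, fun ω => by simp [h]⟩
  · have h' : g⁻¹ ≠ 1 := inv_ne_one.mpr h
    refine ⟨-(g.1 : ℤ), by simp, fun ω => ?_⟩
    have h1 := sgn_mul_sgn g
    have h2 : sgn g⁻¹ = sgn g := by
      rcases Int.units_eq_one_or g.1 with h | h <;> simp [sgn, h]
    simp only [symUnit, Units.val_mk0, symFactor_of_ne h, symFactor_of_ne h', map_inv, h2]
    rw [show ((-(g.1 : ℤ) : ℚ) : ℂ) = -sgn g by simp [sgn]]
    push_cast
    rw [inv_inv]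
    linear_combination (-((half ω.1 g : ℂˣ) : ℂ)) * h1

theorem sgn_sign_mul (g : Mono r) : sgn (sign * g) = -sgn g := by
  simp [sgn, sign]

/-- Generically this is `(h - ε h⁻¹)(h + ε h⁻¹) = h² - h⁻²`. If `g = ±1`, regularisation leaves the
discrepancy `1 - (-1) = 2`, which is why rational constants are divided out. -/
theorem symClass_sq (g : Mono r) : symClass (g ^ 2) = symClass g + symClass (sign * g) := by
  have hs : (sign : Mono r) ≠ 1 := by simpa using sign_mul_vgen_zpow_ne_one (r := r) 0
  have h2 : ∀ ω : GenericPoint r, symFactor ω.1 sign = 2 := fun ω => by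
    rw [symFactor_of_ne hs, half_sign]
    simp [sgn, sign]
    norm_num
  refine congrArg Additive.ofMul (mk_eq_mk_iff.mpr ?_)
  by_cases h : g = 1
  · refine ⟨2, two_ne_zero, fun ω => ?_⟩
    simp [h, symUnit, h2, symFactor_one]
  by_cases h' : sign * g = 1
  · refine ⟨2, two_ne_zero, fun ω => ?_⟩
    have hg : g = sign := by rw [eq_comm, ← inv_mul_eq_one]; exact h'
    rw [hg, sign_sq, ← pow_two, sign_sq]
    simp [symUnit, h2, symFactor_one]
  · refine ⟨1, one_ne_zero, fun ω => ?_⟩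
    have hg : g ^ 2 ≠ 1 := by
      intro hg
      have h3 := isOne_sq g
      rw [isOne_eq_zero h, isOne_eq_zero h', hg] at h3
      simp [isOne] at h3
    have h3 : sgn (g ^ 2) = 1 := by
      change (((g.1 ^ 2 : ℤˣ) : ℤ) : ℂ) = 1
      simp
    have h0 := (half ω.1 g).ne_zero
    have h1 := sgn_mul_sgn g
    simp only [Pi.mul_apply, symUnit, Units.val_mul, Units.val_mk0, symFactor_of_ne h,
      symFactor_of_ne h', symFactor_of_ne hg, h3, sgn_sign_mul, map_mul, half_sign, one_mul,
      map_pow, Units.val_pow_eq_pow_val, Rat.cast_one]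
    field_simp
    linear_combination (-1 : ℂ) * h1

end Mono

end

end AffHecke

namespace AffHecke

noncomputable section

open FormalChar Mono

variable {r : ℕ}

/-! ### Density of the generic points -/

/-- The powers of a transcendental number are linearly independent over `ℤ`; a Liouville number
serves. -/
theorem exists_independent (r : ℕ) :
    ∃ θ : Fin r → ℝ, ∀ χ : Fin r → ℤ, ∑ i, (χ i : ℝ) * θ i = 0 → χ = 0 := by
  have hx := transcendental_liouvilleNumber (m := 2) le_rfl
  refine ⟨fun i => liouvilleNumber (2 : ℕ) ^ (i : ℕ), fun χ hχ => ?_⟩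
  have h : (∑ i : Fin r, Polynomial.C (χ i) * Polynomial.X ^ (i : ℕ) : Polynomial ℤ) = 0 := by
    refine (transcendental_iff.mp hx) _ ?_
    simpa using hχ
  funext i
  have h1 := congrArg (fun p : Polynomial ℤ => p.coeff i) h
  simpa [Polynomial.finsetSum_coeff, Polynomial.coeff_C_mul, Polynomial.coeff_X_pow,
    Fin.val_inj] using h1

/-- A one-parameter family of points. -/
def curve (θ : Fin r → ℝ) (s : Torus r) (τ : ℝ) : Torus r :=
  fun i => s i * Units.mk0 (Complex.exp (τ * θ i)) (Complex.exp_ne_zero _)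

theorem curve_zero (θ : Fin r → ℝ) (s : Torus r) : curve θ s 0 = s := by
  ext i
  simp [curve]

theorem val_curve (v : Param) (θ : Fin r → ℝ) (s : Torus r) (τ : ℝ) (g : Mono r) :
    ((val v (curve θ s τ) g : ℂˣ) : ℂ) =
      (val v s g : ℂ) * Complex.exp ((τ * ∑ i, (wt g i : ℝ) * θ i : ℝ) : ℂ) := by
  rw [val_eq_mul v (curve θ s τ), val_eq_mul v s, charVal, charVal]
  simp only [curve, mul_zpow, Finset.prod_mul_distrib, Units.val_mul, ← mul_assoc]
  congr 1
  push_cast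
  rw [Finset.mul_sum, Complex.exp_sum]
  refine Finset.prod_congr rfl fun i _ => ?_
  rw [Units.val_mk0, ← Complex.exp_int_mul]
  congr 1
  ring

theorem continuous_regFactor_curve (v : Param) (θ : Fin r → ℝ) (s : Torus r) (g : Mono r) :
    Continuous fun τ => regFactor v (curve θ s τ) g := by
  by_cases h : g = 1
  · simp only [regFactor, if_pos h]
    exact continuous_const
  · simp only [regFactor, if_neg h, val_curve]
    refine continuous_const.sub (Continuous.inv₀ (by fun_prop) fun τ => ?_)
    exact mul_ne_zero (Units.ne_zero _) (Complex.exp_ne_zero _)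

/-- A function that vanishes at all generic points vanishes identically if it is continuous along
one-parameter families. -/
theorem eq_zero_of_generic {v : Param} {F : Torus r → ℂ}
    (hF : ∀ θ s, Continuous fun τ => F (curve θ s τ))
    (h : ∀ ω : GenericPoint r, ω.1.1 = v → F (ω.1.2 ^ 2) = 0) (s : Torus r) : F s = 0 := by
  obtain ⟨θ, hθ⟩ := exists_independent r
  have : Countable (Multiplicative ℤ) := inferInstanceAs (Countable ℤ)
  have : Countable (Multiplicative (Fin r → ℤ)) := inferInstanceAs (Countable (Fin r → ℤ))
  -- On the curve the absolute value of a monomial with nonzero weight is strictly monotone in `τ`,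
  -- by the independence of `θ`; weight zero monomials other than `1` never take the value `1`. So
  -- each monomial excludes at most one `τ`, and there are countably many monomials.
  have hbad : (⋃ g : {g : Mono r // g ≠ 1},
      {τ : ℝ | val v (curve θ s τ) g.1 = 1}).Countable := by
    refine Set.countable_iUnion fun g => Set.Subsingleton.countable fun τ hτ τ' hτ' => ?_
    have hw : wt g.1 ≠ 0 := fun hw => g.2 (eq_one_of_val_one hw hτ)
    have hne : ∑ i, (wt g.1 i : ℝ) * θ i ≠ 0 := fun h0 => hw (hθ _ h0)
    have h1 := congrArg (fun z : ℂˣ => (z : ℂ)) (Eq.trans hτ (Eq.symm hτ'))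
    simp only [val_curve] at h1
    have h2 := mul_left_cancel₀ (Units.ne_zero _) h1
    rw [← Complex.ofReal_exp, ← Complex.ofReal_exp, Complex.ofReal_inj] at h2
    exact mul_right_cancel₀ hne (Real.exp_injective h2)
  have hdense := hbad.dense_compl ℝ
  have hzero : ∀ τ ∈ (⋃ g : {g : Mono r // g ≠ 1},
      {τ : ℝ | val v (curve θ s τ) g.1 = 1})ᶜ, F (curve θ s τ) = 0 := by
    intro τ hτ
    simp only [Set.mem_compl_iff, Set.mem_iUnion, not_exists] at hτ
    choose σ hσ using fun i => exists_sq (curve θ s τ i)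
    have hs : σ ^ 2 = curve θ s τ := funext hσ
    rw [← hs]
    refine h ⟨(v, σ), fun g hg => ?_⟩ rfl
    rw [hs]
    exact hτ ⟨g, hg⟩
  have := Continuous.ext_on hdense (hF θ s) continuous_const hzero
  have h0 := congrFun this 0
  rwa [curve_zero] at h0

/-! ### The identity of `μ`-functions at generic points -/

section Generic

variable {l : ℕ} (D : NormalizedHecke (TypeBIndex l) l) (t : Fin l → Mono r)

/-- The product of the symmetric factors in the numerator of a `μ`-function. -/
def symNum : GenericPoint r → ℂˣ := ∏ a, (symUnit (sign * rootProd t a) * symUnit (rootProd t a))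

/-- The product of the symmetric factors in the denominator of a `μ`-function. -/
def symDen : GenericPoint r → ℂˣ :=
  ∏ a, (symUnit (sign * (rootProd t a * vgen ^ D.twoMMinus a)) *
    symUnit (rootProd t a * vgen ^ D.twoMPlus a))

theorem prod_regFactor_num (ω : GenericPoint r) :
    ∏ a, (regFactor ω.1.1 (ω.1.2 ^ 2) (sign * rootProd t a) *
      regFactor ω.1.1 (ω.1.2 ^ 2) (rootProd t a)) = symNum t ω := by
  have h : ∏ a, ((half ω.1 (rootProd t a) : ℂˣ) : ℂ)⁻¹ = 1 := by
    rw [Finset.prod_inv_distrib, ← Units.coe_prod, ← map_prod, prod_rootProd]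
    simp
  simp only [regFactor_eq, map_mul, half_sign, one_mul, symNum, Finset.prod_apply, Pi.mul_apply,
    Units.coe_prod, Units.val_mul, symUnit, Units.val_mk0, Finset.prod_mul_distrib, h]

/-- The half-powers of the roots multiply to `1`. From each root there remains `v` to minus half of
`2m₋(α) + 2m₊(α) = 2 m_R(α^∨)`, and the total is the power of `v` in the definition of `μ`, which
thus cancels there. -/
theorem prod_regFactor_den (ω : GenericPoint r) :
    ∏ a, (regFactor ω.1.1 (ω.1.2 ^ 2) (sign * (rootProd t a * vgen ^ D.twoMMinus a)) *
      regFactor ω.1.1 (ω.1.2 ^ 2) (rootProd t a * vgen ^ D.twoMPlus a)) =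
      (ω.1.1.unit : ℂ) ^ (-D.twoMW) * symDen D t ω := by
  have h : ∏ a, ((half ω.1 (rootProd t a) : ℂˣ) : ℂ)⁻¹ = 1 := by
    rw [Finset.prod_inv_distrib, ← Units.coe_prod, ← map_prod, prod_rootProd]
    simp
  have h2 : ∏ a, (((half ω.1 (vgen ^ D.twoMMinus a) : ℂˣ) : ℂ)⁻¹ *
      ((half ω.1 (vgen ^ D.twoMPlus a) : ℂˣ) : ℂ)⁻¹) = (ω.1.1.unit : ℂ) ^ (-D.twoMW) := by
    have h3 : ∀ a, ((half ω.1 (vgen ^ D.twoMMinus a) : ℂˣ) : ℂ)⁻¹ *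
        ((half ω.1 (vgen ^ D.twoMPlus a) : ℂˣ) : ℂ)⁻¹ =
        (((ω.1.1.unit : ℂˣ) ^ D.mR a 0 : ℂˣ) : ℂ)⁻¹ := by
      intro a
      rw [← mul_inv, ← Units.val_mul, map_zpow, map_zpow, half_vgen, ← zpow_add, ← sqrtUnit_sq,
        ← zpow_natCast (sqrtUnit ω.1.1), ← zpow_mul, NormalizedHecke.twoMMinus,
        NormalizedHecke.twoMPlus]
      congr 4
      push_cast
      ring
    have h4 : ∀ (u : ℂˣ) (f : TypeBIndex l → ℤ), ∏ a, u ^ f a = u ^ ∑ a, f a := fun u f => by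
      have := map_sum (zmultiplesHom (Additive ℂˣ) (Additive.ofMul u)) f Finset.univ
      exact congrArg Additive.toMul this.symm
    simp only [h3]
    rw [Finset.prod_inv_distrib, ← Units.coe_prod, h4, zpow_neg, NormalizedHecke.twoMW,
      Units.val_zpow_eq_zpow_val]
  rw [← h2]
  simp only [regFactor_eq, map_mul, half_sign, one_mul, symDen, Finset.prod_apply, Pi.mul_apply,
    Units.coe_prod, Units.val_mul, symUnit, Units.val_mk0, Finset.prod_mul_distrib, mul_inv, h]
  ring

/-- The projection to functions up to rational constants, written additively. -/
def classHom (r : ℕ) : Additive (GenericPoint r → ℂˣ) →+ Additive (FunModRat r) :=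
  MonoidHom.toAdditive (QuotientGroup.mk' (ratConst r).range)

theorem symClass_eq (g : Mono r) : symClass g = classHom r (Additive.ofMul (symUnit g)) := rfl

theorem muSum_symClass : muSum symClass sign vgen D t =
    classHom r (Additive.ofMul (symNum t)) - classHom r (Additive.ofMul (symDen D t)) := by
  simp only [muSum, symNum, symDen, symClass_eq, ofMul_prod, ofMul_mul, map_sum, map_add]
  exact Finset.sum_sub_distrib (G := Additive (FunModRat r)) _ _

end Generic

theorem symUnit_one : (symUnit 1 : GenericPoint r → ℂˣ) = 1 := by
  ext ω
  simp [symUnit, symFactor_one]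

theorem exists_rat_of_classHom_eq {F F' : GenericPoint r → ℂˣ}
    (h : classHom r (Additive.ofMul F) = classHom r (Additive.ofMul F')) :
    ∃ q : ℚ, q ≠ 0 ∧ ∀ ω, (F' ω : ℂ) = q * (F ω : ℂ) :=
  mk_eq_mk_iff.mp (congrArg Additive.toMul h)

/-- The product that defines the inverse of the rank zero normalising factor. -/
def dProd (n : ℕ) (v : ℝ) : ℝ :=
  ∏ i ∈ Finset.Icc 1 (n / 2), (v ^ ((n : ℤ) - 2 * i) + (v ^ ((n : ℤ) - 2 * i))⁻¹) ^ i

/-- The function on generic points that corresponds to `dProd`. -/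
def symProd (r n : ℕ) : GenericPoint r → ℂˣ :=
  ∏ i ∈ Finset.Icc 1 (n / 2), symUnit (sign * vgen ^ (2 * ((n : ℤ) - 2 * i))) ^ i

theorem half_vgen_zpow (p : Param × Torus r) (k : ℤ) :
    ((half p (vgen ^ (2 * k)) : ℂˣ) : ℂ) = (((p.1 : ℝ) ^ k : ℝ) : ℂ) := by
  rw [map_zpow, half_vgen, zpow_mul, zpow_ofNat, sqrtUnit_sq, Units.val_zpow_eq_zpow_val,
    Complex.ofReal_zpow]
  rfl

theorem symUnit_sign_vgen (ω : GenericPoint r) (k : ℤ) :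
    ((symUnit (sign * vgen ^ (2 * k)) ω : ℂˣ) : ℂ) =
      (((ω.1.1 : ℝ) ^ k + ((ω.1.1 : ℝ) ^ k)⁻¹ : ℝ) : ℂ) := by
  have h : sgn (vgen ^ (2 * k) : Mono r) = 1 := by
    simp [sgn, vgen]
  rw [symUnit, Units.val_mk0, symFactor_of_ne (sign_mul_vgen_zpow_ne_one _), sgn_sign_mul, h,
    map_mul, half_sign, one_mul, half_vgen_zpow]
  push_cast
  ring

theorem symUnit_vgen (ω : GenericPoint r) {k : ℕ} (hk : k ≠ 0) :
    ((symUnit (vgen ^ (2 * k)) ω : ℂˣ) : ℂ) =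
      (((ω.1.1 : ℝ) ^ k - ((ω.1.1 : ℝ) ^ k)⁻¹ : ℝ) : ℂ) := by
  have h : sgn (vgen ^ (2 * k) : Mono r) = 1 := by
    simp [sgn, vgen]
  have h2 := half_vgen_zpow ω.1 k
  rw [show (vgen ^ (2 * (k : ℤ)) : Mono r) = vgen ^ (2 * k) by
    rw [← zpow_natCast]; push_cast; rfl, zpow_natCast] at h2
  rw [symUnit, Units.val_mk0, symFactor_of_ne (vgen_pow_ne_one (by omega)), h, h2]
  push_cast
  ring

theorem symProd_apply (n : ℕ) (ω : GenericPoint r) :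
    ((symProd r n ω : ℂˣ) : ℂ) = (dProd n ω.1.1 : ℂ) := by
  rw [symProd, dProd, Finset.prod_apply, Units.coe_prod, Complex.ofReal_prod]
  refine Finset.prod_congr rfl fun i _ => ?_
  rw [Pi.pow_apply, Units.val_pow_eq_pow_val, symUnit_sign_vgen, Complex.ofReal_pow]

/-- Each factor satisfies `v^k / (1 + q^k) = (v^k + v^(-k))⁻¹`, and `v^k + v^(-k)` is the symmetric
factor of the monomial `-v^(2k)`. -/
theorem dZero_mul_dProd {m m' : ℚ} {n n' : ℕ} (hn : (n : ℚ) = 2 * |m + m'|)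
    (hn' : (n' : ℚ) = 2 * |m - m'|) {v : ℝ} (hv : 1 < v) :
    dZero m m' v * (dProd n' v * dProd n v) = 1 := by
  have hf : ∀ {x : ℚ} {N : ℕ}, (N : ℚ) = 2 * x → ⌊2 * x⌋ = (N : ℤ) ∧ ⌊x⌋₊ = N / 2 := by
    intro x N h
    refine ⟨by rw [← h, Int.floor_natCast], ?_⟩
    rw [show x = (N : ℚ) / (2 : ℕ) by push_cast; linarith, Nat.floor_div_eq_div]
  have h1 : ∀ k : ℤ, ∀ i : ℕ, (v ^ k / (1 + (v ^ 2) ^ k)) ^ i * (v ^ k + (v ^ k)⁻¹) ^ i = 1 := by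
    intro k i
    have hk : 0 < v ^ k := zpow_pos (by linarith) k
    have h2 : (v ^ 2) ^ k = v ^ k * v ^ k := by rw [pow_two, mul_zpow]
    rw [← mul_pow, h2]
    have : v ^ k / (1 + v ^ k * v ^ k) * (v ^ k + (v ^ k)⁻¹) = 1 := by
      field_simp
      ring
    rw [this, one_pow]
  rw [dZero, (hf hn).1, (hf hn).2, (hf hn').1, (hf hn').2, mul_mul_mul_comm, dProd, dProd,
    ← Finset.prod_mul_distrib, ← Finset.prod_mul_distrib]
  simp only [h1, Finset.prod_const_one, mul_one]

end

end AffHecke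

namespace AffHecke

noncomputable section

open FormalChar Mono

variable {r : ℕ}

/-! ### The pull-back of the regularised `μ`-function -/

section Pullback

variable {m m' : ℚ} {M M' : ℕ} {lA lB : List ℕ} {l : ℕ}

theorem add_eq_add_of_sub_eq_sub {G : Type} [AddCommGroup G] {a b c d x y z w : G} {i j : ℕ}
    (h : a - b + i • 0 + x + y = c - d + j • 0 + z + w) : a + d + x + y = c + b + z + w := by
  rw [smul_zero, smul_zero, add_zero, add_zero] at h
  have h2 := congrArg (· + (b + d)) h
  calc a + d + x + y = a - b + x + y + (b + d) := by abel
    _ = c - d + z + w + (b + d) := h2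
    _ = c + b + z + w := by abel

theorem classHom_symProd (n : ℕ) : classHom r (Additive.ofMul (symProd r n)) =
    ∑ i ∈ Finset.Icc 1 (n / 2), i • symClass (sign * vgen ^ (2 * ((n : ℤ) - 2 * i))) := by
  simp only [symProd, symClass_eq, ofMul_prod, ofMul_pow, map_sum, map_nsmul]

/-- The transfer identity for `symClass`, written multiplicatively. The terms `φ(1)` disappear
because a regularised trivial factor is `1`. Generic points include the parameter, so `q` does not
depend on `v`. -/
theorem exists_rat_symNum_symDen (hm : (M : ℚ) = 4 * m) (hm' : (M' : ℚ) = 4 * m') (hM : Odd M)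
    (hM' : Odd M') {n n' : ℕ} (hn : 2 * n = M + M') (hn' : (2 * n' : ℤ) = |(M : ℤ) - M'|)
    (hA : IsExponentList m M lA) (hB : IsExponentList m' M' lB)
    (hl : (monoList r lA lB).length = l) :
    ∃ q : ℚ, q ≠ 0 ∧ ∀ ω : GenericPoint r,
      (symNum (sgen : Fin r → Mono r) ω : ℂ) *
          symDen (targetHecke l (delta m) (delta m')) (fun i => coordMono r lA lB i) ω *
          (symUnit (vgen ^ 2) ω : ℂ) ^ l *
          (symUnit (sign * vgen ^ 2) ω : ℂ) ^ (delta m * delta m') =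
        q * ((symNum (fun i : Fin l => coordMono r lA lB i) ω : ℂ) *
          symDen (sourceHecke r m m') sgen ω * (symUnit (vgen ^ 4) ω : ℂ) ^ r *
          ((symProd r n' ω : ℂ) * symProd r n ω)) := by
  have h := muSum_target (symClass_inv (r := r)) symClass_sq hm hm' hM hM' hn hn' hA hB hl
  rw [muSum_symClass, muSum_symClass, ← classHom_symProd, ← classHom_symProd] at h
  simp only [symClass_eq, symUnit_one, ofMul_one, map_zero] at h
  obtain ⟨q, hq, hF⟩ := exists_rat_of_classHom_eq (r := r)
    (F := symNum (fun i : Fin l => coordMono r lA lB i) * symDen (sourceHecke r m m') sgen *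
      symUnit (vgen ^ 4) ^ r * (symProd r n' * symProd r n))
    (F' := symNum sgen *
      symDen (targetHecke l (delta m) (delta m')) (fun i => coordMono r lA lB i) *
      symUnit (vgen ^ 2) ^ l * symUnit (sign * vgen ^ 2) ^ (delta m * delta m')) (by
    simp only [ofMul_mul, ofMul_pow, map_add, map_nsmul]
    exact add_eq_add_of_sub_eq_sub (G := Additive (FunModRat r)) h)
  exact ⟨q, hq, fun ω => by simpa only [Pi.mul_apply, Pi.pow_apply, Units.val_mul,
    Units.val_pow_eq_pow_val] using hF ω⟩

/-- The product of the regularised factors in the numerator of a `μ`-function. -/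
def regNum (v : Param) (s : Torus r) (t : Fin l → Mono r) : ℂ :=
  ∏ a, (regFactor v s (sign * rootProd t a) * regFactor v s (rootProd t a))

/-- The product of the regularised factors in the denominator of a `μ`-function. -/
def regDen (D : NormalizedHecke (TypeBIndex l) l) (v : Param) (s : Torus r) (t : Fin l → Mono r) :
    ℂ :=
  ∏ a, (regFactor v s (sign * (rootProd t a * vgen ^ D.twoMMinus a)) *
    regFactor v s (rootProd t a * vgen ^ D.twoMPlus a))

theorem continuous_regNum_curve (v : Param) (θ : Fin r → ℝ) (s : Torus r) (t : Fin l → Mono r) :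
    Continuous fun τ => regNum v (curve θ s τ) t :=
  continuous_finsetProd _ fun _ _ =>
    (continuous_regFactor_curve v θ s _).mul (continuous_regFactor_curve v θ s _)

theorem continuous_regDen_curve (D : NormalizedHecke (TypeBIndex l) l) (v : Param)
    (θ : Fin r → ℝ) (s : Torus r) (t : Fin l → Mono r) :
    Continuous fun τ => regDen D v (curve θ s τ) t :=
  continuous_finsetProd _ fun _ _ =>
    (continuous_regFactor_curve v θ s _).mul (continuous_regFactor_curve v θ s _)

theorem targetHecke_d_mul (δ : ℕ) (δ' : ℕ) (ω : GenericPoint r) :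
    ((targetHecke l δ δ').d ω.1.1 : ℂ) *
      ((symUnit (vgen ^ 2) ω : ℂ) ^ l * (symUnit (sign * vgen ^ 2) ω : ℂ) ^ (δ * δ')) = 1 := by
  have h1 := symUnit_vgen ω one_ne_zero
  have h2 := symUnit_sign_vgen ω 1
  rw [mul_one, pow_one] at h1
  rw [mul_one, zpow_ofNat, zpow_one] at h2
  have h3 := (symUnit (vgen ^ 2) ω).ne_zero
  have h4 := (symUnit (sign * vgen ^ 2) ω).ne_zero
  rw [h1] at h3 ⊢
  rw [h2] at h4 ⊢
  simp only [targetHecke, typeBHecke, Complex.ofReal_mul, Complex.ofReal_inv, Complex.ofReal_pow]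
  rw [mul_mul_mul_comm, inv_mul_cancel₀ (pow_ne_zero _ h3), inv_mul_cancel₀ (pow_ne_zero _ h4),
    one_mul]

theorem sourceHecke_d_mul {n n' : ℕ} (hn : (n : ℚ) = 2 * |m + m'|)
    (hn' : (n' : ℚ) = 2 * |m - m'|) (ω : GenericPoint r) :
    ((sourceHecke r m m').d ω.1.1 : ℂ) *
      ((symUnit (vgen ^ 4) ω : ℂ) ^ r * ((symProd r n' ω : ℂ) * symProd r n ω)) = 1 := by
  have h1 := symUnit_vgen ω two_ne_zero
  have h3 := (symUnit (vgen ^ 4) ω).ne_zero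
  rw [show 2 * 2 = 4 from rfl] at h1
  have h := dZero_mul_dProd hn hn' ω.1.1.2
  rw [symProd_apply, symProd_apply, ← Complex.ofReal_mul]
  rw [h1] at h3 ⊢
  simp only [sourceHecke, typeBHecke]
  rw [Complex.ofReal_mul (_⁻¹), Complex.ofReal_inv, Complex.ofReal_pow, mul_mul_mul_comm,
    inv_mul_cancel₀ (pow_ne_zero _ h3), one_mul, ← Complex.ofReal_mul, h, Complex.ofReal_one]

/-- The leftover symmetric factors of powers of `v` are the inverses of the two normalising factors.
The identity is kept in cross-multiplied form, so that both sides are continuous along the curves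
and the generic case suffices. -/
theorem exists_rat_regNum_regDen (hm : (M : ℚ) = 4 * m) (hm' : (M' : ℚ) = 4 * m') (hM : Odd M)
    (hM' : Odd M') (hA : IsExponentList m M lA) (hB : IsExponentList m' M' lB)
    (hl : (monoList r lA lB).length = l) (D₁ : NormalizedHecke (TypeBIndex r) r)
    (D₂ : NormalizedHecke (TypeBIndex l) l) (hD₁ : D₁ = sourceHecke r m m')
    (hD₂ : D₂ = targetHecke l (delta m) (delta m')) :
    ∃ c : ℚ, c ≠ 0 ∧ ∀ (v : Param) (s : Torus r),
      ((D₂.d v : ℂ) * (v.unit : ℂ) ^ (-D₂.twoMW) *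
          regNum v s (fun i : Fin l => coordMono r lA lB i)) * regDen D₁ v s sgen =
        c * ((D₁.d v : ℂ) * (v.unit : ℂ) ^ (-D₁.twoMW) * regNum v s sgen) *
          regDen D₂ v s (fun i => coordMono r lA lB i) := by
  obtain ⟨n, n', hn, hn'⟩ := exists_dNat hM hM'
  have hq : (n : ℚ) = 2 * |m + m'| := by
    have h : (2 * n : ℚ) = M + M' := by exact_mod_cast hn
    have h0 : 0 ≤ m + m' := by
      have : (0 : ℚ) ≤ M + M' := by positivity
      linarith
    rw [abs_of_nonneg h0]
    linarith
  have hq' : (n' : ℚ) = 2 * |m - m'| := by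
    have h : (2 * n' : ℚ) = |(M : ℚ) - M'| := by exact_mod_cast hn'
    rw [hm, hm', ← mul_sub, abs_mul, abs_of_pos (by norm_num : (0 : ℚ) < 4)] at h
    linarith
  obtain ⟨q, hq0, h⟩ := exists_rat_symNum_symDen hm hm' hM hM' hn hn' hA hB hl
  refine ⟨q⁻¹, inv_ne_zero hq0, fun v s => ?_⟩
  rw [← sub_eq_zero]
  refine eq_zero_of_generic (v := v) (F := fun s =>
    ((D₂.d v : ℂ) * (v.unit : ℂ) ^ (-D₂.twoMW) *
          regNum v s (fun i : Fin l => coordMono r lA lB i)) * regDen D₁ v s sgen -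
        ((q⁻¹ : ℚ) : ℂ) * ((D₁.d v : ℂ) * (v.unit : ℂ) ^ (-D₁.twoMW) * regNum v s sgen) *
          regDen D₂ v s (fun i => coordMono r lA lB i)) (fun θ s => ?_) (fun ω hω => ?_) s
  · exact ((continuous_const.mul (continuous_regNum_curve v θ s _)).mul
      (continuous_regDen_curve D₁ v θ s _)).sub
      ((continuous_const.mul (continuous_const.mul (continuous_regNum_curve v θ s _))).mul
      (continuous_regDen_curve D₂ v θ s _))
  · subst hω
    have e2 := targetHecke_d_mul (l := l) (delta m) (delta m') ω
    have e1 := sourceHecke_d_mul hq hq' ω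
    have h0 := h ω
    rw [← hD₂] at e2 h0
    rw [← hD₁] at e1 h0
    have hqc : (q : ℂ) ≠ 0 := by exact_mod_cast hq0
    simp only [regNum, regDen, prod_regFactor_num, prod_regFactor_den, Rat.cast_inv]
    generalize (symNum (fun i : Fin l => coordMono r lA lB i) ω : ℂ) = N₂ at *
    generalize (symNum (sgen : Fin r → Mono r) ω : ℂ) = N₁ at *
    generalize (symDen D₁ sgen ω : ℂ) = E₁ at *
    generalize (symDen D₂ (fun i => coordMono r lA lB i) ω : ℂ) = E₂ at *
    generalize (symUnit (vgen ^ 2) ω : ℂ) ^ l = A at *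
    generalize (symUnit (sign * vgen ^ 2) ω : ℂ) ^ (delta m * delta m') = B at *
    generalize (symUnit (vgen ^ 4) ω : ℂ) ^ r = C at *
    generalize (symProd r n' ω : ℂ) * symProd r n ω = P at *
    generalize (D₁.d ω.1.1 : ℂ) = d₁ at *
    generalize (D₂.d ω.1.1 : ℂ) = d₂ at *
    have key : d₂ * N₂ * E₁ = (q : ℂ)⁻¹ * (d₁ * N₁) * E₂ := by
      field_simp
      linear_combination (-(d₁ * d₂)) * h0 + N₁ * E₂ * d₁ * e2 - q * N₂ * E₁ * d₂ * e1
    linear_combination (ω.1.1.unit : ℂ) ^ (-D₂.twoMW) * (ω.1.1.unit : ℂ) ^ (-D₁.twoMW) * key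

end Pullback

end

end AffHecke

/-! ### The spectral transfer morphism -/

open AffHecke AffHecke.FormalChar AffHecke.Mono in
theorem mainTheorem1 (r : ℕ) (mMinus mPlus : ℚ)
    (hMinus : AffHecke.IsQuarter mMinus) (hPlus : AffHecke.IsQuarter mPlus)
    (hMinus0 : 0 < mMinus) (hPlus0 : 0 < mPlus) :
    AffHecke.IsSpectralTransferMorphism
      (AffHecke.sourceHecke r mMinus mPlus)
      (AffHecke.targetHecke (AffHecke.targetRank r mMinus mPlus)
        (AffHecke.delta mMinus) (AffHecke.delta mPlus))
      (AffHecke.xi r mMinus mPlus) := by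
  obtain ⟨M, lA, hm, hM, hA⟩ := exists_exponentList hMinus hMinus0
  obtain ⟨M', lB, hm', hM', hB⟩ := exists_exponentList hPlus hPlus0
  have hl : (monoList r lA lB).length = targetRank r mMinus mPlus := by
    -- The length of the formal list involves neither `v` nor `s`, so it may be read off at `v = 2`,
    -- `s = 1`.
    have h := length_xiList r mMinus mPlus hMinus hPlus hMinus0 hPlus0 ⟨2, Set.mem_Ioi.mpr one_lt_two⟩ 1
    rwa [xiList_eq hA.1 hB.1, List.length_map] at h
  have hxi := xi_eq_monomialMap (r := r) hA.1 hB.1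
  have hval := xi_eq (r := r) hA.1 hB.1
  obtain ⟨σ, hσ⟩ := exists_section hl
  refine ⟨fun v => ?_, fun v => ?_, fun v => ⟨⟨1, rfl⟩, ?_⟩, fun v s s' => ?_, ?_⟩
  · have h := ncard_eq_muSum (D := targetHecke _ (delta mMinus) (delta mPlus)) rfl (hval v)
    rw [isOne_target hm hm' hM hM' hA hB hl] at h
    rw [hxi] at h ⊢
    exact isResidualCoset_monomialMap _ hσ _ v h
  · rw [hxi]
    exact isFiniteMorphism_monomialMap _ hσ
  · rw [hxi]
    exact one_mem_subtorusOf _ _ rfl (prod_coord_zpow hl v)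
  · rw [hxi]
    exact monomialMap_hom _ _ s s'
  · obtain ⟨c, hc, h⟩ := exists_rat_regNum_regDen hm hm' hM hM' hA hB hl _ _ rfl rfl
    refine ⟨c, hc, fun v s h₁ h₂ => ?_⟩
    rw [← mul_div_assoc, div_eq_div_iff h₂ h₁, muRegNum_eq rfl (hval v), muRegDen_eq rfl (hval v),
      muNum_eq v s rfl, muDen_eq v s rfl]
    exact h v s
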